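/- Let $K$ be a field, $C$ a smooth, projective (integral) curve over $K$, $E$ a vector bundle of rank $r\ge 1$ on $C$, $L$ a line bundle on $C$, $\psi:\det E\xrightarrow{\ \sim\ } L$ an isomorphism and $\xi: L\to\Omega^1_{C/K}$ a morphism which is not identically zero. For sections $P_1,\dots,P_{N'}:\operatorname{Spec}K\to C$ of the structure morphism with pairwise disjoint images, put $D=\sum_i P_i$ and let $\langle\,,\dots,\rangle_\xi$ be the $K$-valued alternating $r$-linear form on $Q_D:=\Gamma\big(C,E(D)/E(-(r-1)D)\big)$ given by $$\langle s_1,\dots,s_r\rangle_\xi=\sum_{i}\operatorname{res}_{P_i}(\xi\circ\psi)(\tilde s_1\wedge\dots\wedge\tilde s_r),$$ where $\tilde s_j$ is any local representative in $E(D)$ of $s_j$ near $P_i$. A subspace $W$ of $\Gamma(C,E)$ is called degenerate for the form if $\langle w_1,\dots,w_{r-1},q\rangle_\xi=0$ for all $w_1,\dots,w_{r-1}$ in the image of $W$ in $Q_D$ and all $q\in Q_D$. Let $V\subseteq\Gamma(C,E)$ be a $K$-subspace of finite dimension $k$, let $n\le k$, and suppose that no $n$-dimensional subspace of $V$ is contained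 in a subbundle of $E$ of rank $r-2$ (for $r=1$ there are no such subbundles and the condition is void). Here a subbundle is a locally free subsheaf with locally free quotient. Then there exists an integer $N>0$ such that for all $N'>N$ and all pairwise disjoint sections $P_1,\dots,P_{N'}$ of $C\to\operatorname{Spec}K$, no $n$-dimensional subspace $W\subseteq V$ is degenerate for $\langle\,,\dots,\rangle_\xi$. -/

import Mathlib

open AlgebraicGeometry CategoryTheory TopologicalSpace

universe u

noncomputable section

namespace CurveForms

/-! ### Sheaves of modules, frames, vector bundles, subbundles -/

section Bundles

variable {C : Scheme.{u}}

/-- Restriction of a section of a sheaf of modules to a smaller open set. -/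
def res (M : C.Modules) {U V : C.Opens} (h : V ≤ U) : Γ(M, U) →+ Γ(M, V) :=
  (M.presheaf.map (homOfLE h).op).hom

/-- `e` is a frame of `M` over `U`: the restrictions of the `e i` form a basis of the module
of sections over every open subset of `U`, i.e. `e` is an isomorphism of the free module
on `ι` onto the restriction of `M` to `U`. -/
def IsFrame (M : C.Modules) {U : C.Opens} {ι : Type} (e : ι → Γ(M, U)) : Prop :=
  ∀ (V : C.Opens) (h : V ≤ U),
    LinearIndependent Γ(C, V) (fun i => res M h (e i)) ∧
      Submodule.span Γ(C, V) (Set.range fun i => res M h (e i)) = ⊤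

/-- `M` is a vector bundle (locally free sheaf) of rank `r`. -/
def IsVectorBundle (M : C.Modules) (r : ℕ) : Prop :=
  ∀ x : C, ∃ U : C.Opens, x ∈ U ∧ ∃ e : Fin r → Γ(M, U), IsFrame M e

/-- A subbundle of rank `s` of `E`: a subsheaf of modules which is locally the span of the first
`s` members of a frame of `E` (that is, a locally free subsheaf of rank `s` with locally free
quotient). -/
structure Subbundle (E : C.Modules) (s : ℕ) where
  sections : ∀ U : C.Opens, Submodule Γ(C, U) Γ(E, U)
  res_mem : ∀ {U V : C.Opens} (h : V ≤ U) (t : Γ(E, U)), t ∈ sections U → res E h t ∈ sections V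
  local_mem : ∀ (U : C.Opens) (t : Γ(E, U)),
    (∀ x ∈ U, ∃ (V : C.Opens) (h : V ≤ U), x ∈ V ∧ res E h t ∈ sections V) → t ∈ sections U
  exists_frame : ∀ x : C, ∃ U : C.Opens, x ∈ U ∧ ∃ (q : ℕ) (e : Fin s ⊕ Fin q → Γ(E, U)),
    IsFrame E e ∧ ∀ (V : C.Opens) (h : V ≤ U),
      sections V = Submodule.span Γ(C, V) (Set.range fun i => res E h (e (Sum.inl i)))

/-- An isomorphism from the determinant (top exterior power) of a rank-`r` bundle `E` onto a line
bundle `L`. By the universal property of the exterior power, a morphism from it to `L` is a family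
of alternating maps on sections, compatible with restriction; it is an isomorphism exactly when it
carries local frames of `E` to local generators of `L`. -/
structure DetIso (r : ℕ) (E L : C.Modules) where
  app : ∀ U : C.Opens, Γ(E, U) [⋀^Fin r]→ₗ[Γ(C, U)] Γ(L, U)
  app_res : ∀ {U V : C.Opens} (h : V ≤ U) (t : Fin r → Γ(E, U)),
    app V (fun i => res E h (t i)) = res L h (app U t)
  isFrame : ∀ {U : C.Opens} (e : Fin r → Γ(E, U)), IsFrame E e →
    IsFrame L (fun _ : Unit => app U e)

end Bundles

/-! ### Generic stalks -/

section Generic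

variable {C : Scheme.{u}} [IsIntegral C]

theorem generic_mem {U : C.Opens} {x : C} (h : x ∈ U) : genericPoint C ∈ U :=
  ((genericPoint_spec C).mem_open_set_iff U.isOpen).mpr ⟨x, trivial, h⟩

/-- The stalk of a sheaf of modules at the generic point, a vector space over the
function field. -/
def GenericStalk (M : C.Modules) : Type u := M.presheaf.stalk (genericPoint C)

instance (M : C.Modules) : AddCommGroup (GenericStalk M) :=
  inferInstanceAs (AddCommGroup (M.presheaf.stalk (genericPoint C)))

instance (M : C.Modules) : Module C.functionField (GenericStalk M) :=
  PresheafOfModules.instModuleCarrierStalkCommRingCatCarrierAbPresheafOpensCarrier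
    (R := C.presheaf) M.val (genericPoint C)

/-- The germ at the generic point of a section over a nonempty open set. -/
def germ (M : C.Modules) {U : C.Opens} (hU : genericPoint C ∈ U) : Γ(M, U) →+ GenericStalk M :=
  (M.presheaf.germ U (genericPoint C) hU).hom

/-- The germ at the generic point of a regular function on a nonempty open set. -/
def funGerm {U : C.Opens} (hU : genericPoint C ∈ U) : Γ(C, U) →+* C.functionField :=
  (C.presheaf.germ U (genericPoint C) hU).hom

theorem germ_smul (M : C.Modules) {U : C.Opens} (hU : genericPoint C ∈ U) (a : Γ(C, U))
    (t : Γ(M, U)) : germ M hU (a • t) = funGerm hU a • germ M hU t :=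
  PresheafOfModules.germ_smul (R := C.presheaf) M.val (genericPoint C) U hU a t

theorem germ_res (M : C.Modules) {U V : C.Opens} (h : V ≤ U) (hV : genericPoint C ∈ V)
    (t : Γ(M, U)) : germ M hV (res M h t) = germ M (h hV) t :=
  TopCat.Presheaf.germ_res_apply M.presheaf (homOfLE h) _ hV t

theorem exists_germ (M : C.Modules) (s : GenericStalk M) :
    ∃ (U : C.Opens) (hU : genericPoint C ∈ U) (t : Γ(M, U)), germ M hU t = s :=
  TopCat.Presheaf.exists_germ_eq M.presheaf s

theorem exists_funGerm (a : C.functionField) :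
    ∃ (U : C.Opens) (hU : genericPoint C ∈ U) (f : Γ(C, U)), funGerm hU f = a :=
  TopCat.Presheaf.exists_germ_eq C.presheaf a

/-- `s` is the germ of a section defined near `x`, i.e. it lies in the image of the stalk at `x`
in the generic stalk. -/
def IsSectionAt (M : C.Modules) (x : C) (s : GenericStalk M) : Prop :=
  ∃ (U : C.Opens) (hx : x ∈ U) (t : Γ(M, U)), germ M (generic_mem hx) t = s

theorem isSectionAt_generic (M : C.Modules) (s : GenericStalk M) :
    IsSectionAt M (genericPoint C) s := exists_germ M s

theorem exists_common (M : C.Modules) {ι : Type} [Finite ι] (x : C) (s : ι → GenericStalk M)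
    (hs : ∀ i, IsSectionAt M x (s i)) :
    ∃ (U : C.Opens) (hx : x ∈ U) (t : ι → Γ(M, U)),
      (∀ i, germ M (generic_mem hx) (t i) = s i) ∧ ∀ i j, s i = s j → t i = t j := by
  classical
  have := Fintype.ofFinite ι
  have H : ∀ e : Set.range s, IsSectionAt M x e.1 := by rintro ⟨_, i, rfl⟩; exact hs i
  choose U hx t ht using H
  let f : ι → Set.range s := fun i => ⟨s i, i, rfl⟩
  have hle : ∀ i, (Finset.univ.inf fun i => U (f i)) ≤ U (f i) :=
    fun i => Finset.inf_le (Finset.mem_univ i)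
  have hxW : x ∈ (Finset.univ.inf fun i => U (f i)) := by
    have : ∀ S : Finset ι, x ∈ S.inf fun i => U (f i) := by
      intro S
      induction S using Finset.induction_on with
      | empty => simp
      | insert a S ha ih => rw [Finset.inf_insert]; exact ⟨hx _, ih⟩
    exact this _
  refine ⟨_, hxW, fun i => res M (hle i) (t (f i)), fun i => ?_, fun i j hij => ?_⟩
  · rw [germ_res]; exact ht (f i)
  · have key : ∀ (a b : Set.range s) (ha : _ ≤ U a) (hb : _ ≤ U b), a = b →
        res M (V := Finset.univ.inf fun i => U (f i)) ha (t a) = res M hb (t b) := by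
      rintro a b ha hb rfl; rfl
    exact key _ _ _ _ (Subtype.ext hij)

theorem exists_eq_of_germ (M : C.Modules) {ι : Type} [Finite ι] {U U' : C.Opens}
    (hU : genericPoint C ∈ U) (hU' : genericPoint C ∈ U') (t : ι → Γ(M, U)) (t' : ι → Γ(M, U'))
    (h : ∀ i, germ M hU (t i) = germ M hU' (t' i)) :
    ∃ (W : C.Opens) (_ : genericPoint C ∈ W) (h₁ : W ≤ U) (h₂ : W ≤ U'),
      ∀ i, res M h₁ (t i) = res M h₂ (t' i) := by
  classical
  have := Fintype.ofFinite ι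
  have H : ∀ i, ∃ (W : C.Opens) (_ : genericPoint C ∈ W) (h₁ : W ≤ U) (h₂ : W ≤ U'),
      res M h₁ (t i) = res M h₂ (t' i) := by
    intro i
    obtain ⟨W, hW, i₁, i₂, e⟩ := TopCat.Presheaf.germ_eq M.presheaf _ hU hU' _ _ (h i)
    exact ⟨W, hW, i₁.le, i₂.le, e⟩
  choose W hW h₁ h₂ e using H
  have hle : ∀ i, (U ⊓ U' ⊓ Finset.univ.inf W) ≤ W i :=
    fun i => inf_le_right.trans (Finset.inf_le (Finset.mem_univ i))
  have hres : ∀ {A B D : C.Opens} (p : B ≤ A) (q : D ≤ B) (z : Γ(M, A)),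
      res M q (res M p z) = res M (q.trans p) z := by
    intro A B D p q z
    change (M.presheaf.map _ ≫ M.presheaf.map _) z = M.presheaf.map _ z
    rw [← M.presheaf.map_comp]
    rfl
  refine ⟨U ⊓ U' ⊓ Finset.univ.inf W, ⟨⟨hU, hU'⟩, ?_⟩, inf_le_left.trans inf_le_left,
    inf_le_left.trans inf_le_right, fun i => ?_⟩
  · have : ∀ S : Finset ι, genericPoint C ∈ S.inf W := by
      intro S
      induction S using Finset.induction_on with
      | empty => simp
      | insert a S ha ih => rw [Finset.inf_insert]; exact ⟨hW _, ih⟩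
    exact this _
  · have := congrArg (res M (hle i)) (e i)
    rw [hres, hres] at this
    exact this

end Generic

/-! ### The ground field -/

section GroundField

variable {C : Scheme.{u}} {K : Type u} [Field K] [C.Over (Spec (CommRingCat.of K))]

variable (C K) in
/-- The constants of the ground field as global regular functions. -/
def const : K →+* Γ(C, ⊤) :=
  (C ↘ Spec (CommRingCat.of K)).appTop.hom.comp (Scheme.ΓSpecIso (CommRingCat.of K)).inv.hom

instance (x : C) : Algebra K (C.presheaf.stalk x) :=
  ((C.presheaf.germ ⊤ x trivial).hom.comp (const C K)).toAlgebra

/-- The vector space of global sections. -/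
def GlobalSections (M : C.Modules) : Type u := Γ(M, ⊤)

instance (M : C.Modules) : AddCommGroup (GlobalSections M) :=
  inferInstanceAs (AddCommGroup Γ(M, ⊤))

instance (M : C.Modules) : Module Γ(C, ⊤) (GlobalSections M) :=
  inferInstanceAs (Module Γ(C, ⊤) Γ(M, ⊤))

instance (M : C.Modules) : Module K (GlobalSections M) :=
  Module.compHom _ (const C K)

variable [IsIntegral C]

instance (x : C) : IsScalarTower K (C.presheaf.stalk x) C.functionField := by
  apply IsScalarTower.of_algebraMap_eq
  intro k
  exact (ConcreteCategory.congr_hom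
    (C.presheaf.germ_stalkSpecializes (U := ⊤) trivial _) (const C K k)).symm

instance (M : C.Modules) : Module K (GenericStalk M) :=
  Module.compHom _ (algebraMap K C.functionField)

instance (M : C.Modules) : IsScalarTower K C.functionField (GenericStalk M) :=
  IsScalarTower.of_algebraMap_smul fun _ _ => rfl

/-- The germ of a global section at the generic point. -/
def globalGerm (M : C.Modules) : GlobalSections M →ₗ[K] GenericStalk M where
  toFun t := germ M (U := ⊤) trivial t
  map_add' := map_add _
  map_smul' k t := germ_smul M (U := ⊤) trivial (const C K k) t

theorem algebraMap_eq_funGerm (k : K) :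
    algebraMap K C.functionField k = funGerm (U := ⊤) trivial (const C K k) := rfl

theorem exists_stalk_germ {x : C} (a : C.presheaf.stalk x) :
    ∃ (U : C.Opens) (hx : x ∈ U) (f : Γ(C, U)),
      funGerm (generic_mem hx) f = algebraMap (C.presheaf.stalk x) C.functionField a := by
  obtain ⟨U, hx, f, rfl⟩ := TopCat.Presheaf.exists_germ_eq C.presheaf a
  exact ⟨U, hx, f, (ConcreteCategory.congr_hom
    (C.presheaf.germ_stalkSpecializes hx ((genericPoint_spec C).specializes trivial)) f).symm⟩

theorem IsSectionAt.smul {M : C.Modules} {x : C} {s : GenericStalk M} (hs : IsSectionAt M x s)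
    (a : C.presheaf.stalk x) :
    IsSectionAt M x (algebraMap (C.presheaf.stalk x) C.functionField a • s) := by
  obtain ⟨U, hU, t, rfl⟩ := hs
  obtain ⟨V, hV, f, hf⟩ := exists_stalk_germ a
  let f' : Γ(C, U ⊓ V) := C.presheaf.map (homOfLE (inf_le_right : U ⊓ V ≤ V)).op f
  refine ⟨U ⊓ V, ⟨hU, hV⟩, f' • res M (inf_le_left : U ⊓ V ≤ U) t, ?_⟩
  rw [germ_smul, germ_res, ← hf]
  congr 1
  exact TopCat.Presheaf.germ_res_apply C.presheaf (homOfLE inf_le_right) _ _ f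

variable (K) in
/-- The stalk of `M` at `x`, as a subspace of the generic stalk. -/
def stalkAt (M : C.Modules) (x : C) : Submodule K (GenericStalk M) where
  carrier := {s | IsSectionAt M x s}
  zero_mem' := ⟨⊤, trivial, 0, map_zero _⟩
  add_mem' := by
    rintro _ _ ⟨U, hU, t, rfl⟩ ⟨V, hV, t', rfl⟩
    refine ⟨U ⊓ V, ⟨hU, hV⟩, res M inf_le_left t + res M inf_le_right t', ?_⟩
    rw [map_add, germ_res, germ_res]
  smul_mem' k s hs := by
    have := IsSectionAt.smul hs (algebraMap K (C.presheaf.stalk x) k)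
    rwa [← IsScalarTower.algebraMap_apply, algebraMap_smul] at this

end GroundField

/-! ### Differentials and residues -/

section Differentials

variable {C : Scheme.{u}} [IsIntegral C] (K : Type u) [Field K]
  [C.Over (Spec (CommRingCat.of K))]

/-- The rational differentials which are regular at `x`: the stalk at `x` of the sheaf of
differentials of the smooth curve `C`, inside its generic stalk. -/
def regularAt (x : C) : Submodule (C.presheaf.stalk x) Ω[C.functionField⁄K] :=
  LinearMap.range (KaehlerDifferential.map K K (C.presheaf.stalk x) C.functionField)

/-- A morphism from `L` to the sheaf of differentials of the smooth curve `C`, whose sections over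
a nonempty open set `U` are the rational differentials regular at all points of `U`. -/
structure DiffHom (L : C.Modules) where
  app : ∀ U : C.Opens, genericPoint C ∈ U → Γ(L, U) →+ Ω[C.functionField⁄K]
  app_smul : ∀ (U : C.Opens) (hU : genericPoint C ∈ U) (a : Γ(C, U)) (t : Γ(L, U)),
    app U hU (a • t) = funGerm hU a • app U hU t
  app_res : ∀ {U V : C.Opens} (h : V ≤ U) (hV : genericPoint C ∈ V) (t : Γ(L, U)),
    app V hV (res L h t) = app U (h hV) t
  regular : ∀ (U : C.Opens) (hU : genericPoint C ∈ U) (t : Γ(L, U)), ∀ x ∈ U,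
    app U hU t ∈ regularAt K x

variable {K} in
/-- The morphism is not identically zero. -/
def DiffHom.NeZero {L : C.Modules} (ξ : DiffHom K L) : Prop :=
  ∃ (U : C.Opens) (hU : genericPoint C ∈ U) (t : Γ(L, U)), ξ.app U hU t ≠ 0

variable {K} in
/-- `ρ` is the residue map at the rational point `x`: for a local parameter `t` at `x`, it kills
the regular differentials and sends `t⁻¹ dt` to `1` and `t⁻ʲ dt` to `0` for `j ≥ 2`. These
conditions determine `ρ`, and the outcome does not depend on `t`. -/
def IsResidueAt (x : C) (ρ : Ω[C.functionField⁄K] →ₗ[K] K) : Prop :=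
  ∃ t : C.presheaf.stalk x, IsLocalRing.maximalIdeal (C.presheaf.stalk x) = Ideal.span {t} ∧
    (∀ ω ∈ regularAt K x, ρ ω = 0) ∧
    ∀ j : ℕ, ρ (((algebraMap (C.presheaf.stalk x) C.functionField t) ^ (j + 1))⁻¹ •
      KaehlerDifferential.D K C.functionField
        (algebraMap (C.presheaf.stalk x) C.functionField t)) = if j = 0 then 1 else 0

open Classical in
/-- The residue of rational differentials at a rational point of the smooth curve `C`. -/
def residue (x : C) : Ω[C.functionField⁄K] →ₗ[K] K :=
  if h : ∃ ρ : Ω[C.functionField⁄K] →ₗ[K] K, IsResidueAt x ρ then h.choose else 0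

theorem residue_regular (x : C) {ω : Ω[C.functionField⁄K]} (hω : ω ∈ regularAt K x) :
    residue K x ω = 0 := by
  unfold residue
  split_ifs with h
  · obtain ⟨t, -, h0, -⟩ := h.choose_spec
    exact h0 ω hω
  · rfl

theorem smul_mem_regularAt {x : C} (a : C.presheaf.stalk x) {ω : Ω[C.functionField⁄K]}
    (hω : ω ∈ regularAt K x) :
    algebraMap (C.presheaf.stalk x) C.functionField a • ω ∈ regularAt K x := by
  rw [algebraMap_smul]
  exact Submodule.smul_mem _ a hω

end Differentials

/-! ### The composite of `ψ` and `ξ` on rational sections -/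

section GenericForm

variable {C : Scheme.{u}} [IsIntegral C] {K : Type u} [Field K]
  [C.Over (Spec (CommRingCat.of K))] {r : ℕ} {E L : C.Modules}

/-- The value `ξ (ψ (t₁ ∧ ⋯ ∧ tᵣ))` for sections over a nonempty open set. -/
def localForm (ψ : DetIso r E L) (ξ : DiffHom K L) {U : C.Opens} (hU : genericPoint C ∈ U)
    (t : Fin r → Γ(E, U)) : Ω[C.functionField⁄K] :=
  ξ.app U hU (ψ.app U t)

theorem localForm_res (ψ : DetIso r E L) (ξ : DiffHom K L) {U V : C.Opens} (h : V ≤ U)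
    (hV : genericPoint C ∈ V) (t : Fin r → Γ(E, U)) :
    localForm ψ ξ hV (fun i => res E h (t i)) = localForm ψ ξ (h hV) t := by
  rw [localForm, ψ.app_res, ξ.app_res]; rfl

theorem localForm_congr (ψ : DetIso r E L) (ξ : DiffHom K L) {U U' : C.Opens}
    (hU : genericPoint C ∈ U) (hU' : genericPoint C ∈ U') (t : Fin r → Γ(E, U))
    (t' : Fin r → Γ(E, U')) (h : ∀ i, germ E hU (t i) = germ E hU' (t' i)) :
    localForm ψ ξ hU t = localForm ψ ξ hU' t' := by
  obtain ⟨W, hW, h₁, h₂, e⟩ := exists_eq_of_germ E hU hU' t t' h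
  rw [← localForm_res ψ ξ h₁ hW, ← localForm_res ψ ξ h₂ hW, funext e]

/-- The value of `ξ ∘ ψ` on rational sections, computed on any common open set of definition. -/
def genericValue (ψ : DetIso r E L) (ξ : DiffHom K L) (s : Fin r → GenericStalk E) :
    Ω[C.functionField⁄K] :=
  localForm ψ ξ
    (generic_mem (exists_common E _ s fun i => isSectionAt_generic E (s i)).choose_spec.choose)
    (exists_common E _ s fun i => isSectionAt_generic E (s i)).choose_spec.choose_spec.choose

theorem genericValue_germ (ψ : DetIso r E L) (ξ : DiffHom K L) {U : C.Opens}
    (hU : genericPoint C ∈ U) (t : Fin r → Γ(E, U)) (s : Fin r → GenericStalk E)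
    (h : ∀ i, germ E hU (t i) = s i) :
    genericValue ψ ξ s = localForm ψ ξ hU t := by
  refine localForm_congr ψ ξ _ _ _ _ fun i => ?_
  rw [h]
  exact (exists_common E _ s
    fun i => isSectionAt_generic E (s i)).choose_spec.choose_spec.choose_spec.1 i

/-- The alternating form `ξ ∘ ψ` on rational sections of `E`, with values in the rational
differentials. -/
def genericForm (ψ : DetIso r E L) (ξ : DiffHom K L) :
    GenericStalk E [⋀^Fin r]→ₗ[C.functionField] Ω[C.functionField⁄K] where
  toFun := genericValue ψ ξ
  map_update_add' := by
    intro inst s i a b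
    obtain rfl := Subsingleton.elim inst (instDecidableEqFin r)
    obtain ⟨U, hU, t, ht, -⟩ := exists_common E _ (Sum.elim s ![a, b])
      fun i => isSectionAt_generic E _
    have hs : ∀ j, germ E hU (t (Sum.inl j)) = s j := fun j => ht (Sum.inl j)
    have ha : germ E hU (t (Sum.inr 0)) = a := ht (Sum.inr 0)
    have hb : germ E hU (t (Sum.inr 1)) = b := ht (Sum.inr 1)
    have key : ∀ c : Γ(E, U), genericValue ψ ξ (Function.update s i (germ E hU c)) =
        localForm ψ ξ hU (Function.update (fun j => t (Sum.inl j)) i c) := by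
      intro c
      refine genericValue_germ ψ ξ hU _ _ fun j => ?_
      rcases eq_or_ne j i with rfl | hj
      · simp
      · simp [hj, hs]
    rw [← ha, ← hb, ← map_add, key, key, key]
    simp [localForm]
  map_update_smul' := by
    intro inst s i c a
    obtain rfl := Subsingleton.elim inst (instDecidableEqFin r)
    obtain ⟨U₀, hU₀, t₀, ht₀, -⟩ := exists_common E _ (Sum.elim s ![a])
      fun i => isSectionAt_generic E _
    obtain ⟨V, hV, f, rfl⟩ := exists_funGerm c
    let U := U₀ ⊓ V
    have hU : genericPoint C ∈ U := ⟨hU₀, hV⟩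
    let t := fun j => res E (inf_le_left : U ≤ U₀) (t₀ j)
    have hs : ∀ j, germ E hU (t (Sum.inl j)) = s j :=
      fun j => (germ_res _ _ _ _).trans (ht₀ (Sum.inl j))
    have ha : germ E hU (t (Sum.inr 0)) = a := (germ_res _ _ _ _).trans (ht₀ (Sum.inr 0))
    have hf : funGerm hU (C.presheaf.map (homOfLE (inf_le_right : U ≤ V)).op f) = funGerm hV f :=
      TopCat.Presheaf.germ_res_apply C.presheaf (homOfLE inf_le_right) _ _ f
    have key : ∀ c : Γ(E, U), genericValue ψ ξ (Function.update s i (germ E hU c)) =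
        localForm ψ ξ hU (Function.update (fun j => t (Sum.inl j)) i c) := by
      intro c
      refine genericValue_germ ψ ξ hU _ _ fun j => ?_
      rcases eq_or_ne j i with rfl | hj
      · simp
      · simp [hj, hs]
    rw [← ha, ← hf, ← germ_smul, key, key]
    simp [localForm, ξ.app_smul]
  map_eq_zero_of_eq' := by
    intro s i j hij hne
    obtain ⟨U, hU, t, ht, hinj⟩ := exists_common E _ s fun i => isSectionAt_generic E (s i)
    rw [genericValue_germ ψ ξ hU t s ht, localForm,
      (ψ.app U).map_eq_zero_of_eq t (hinj i j hij) hne, map_zero]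

theorem genericForm_regular (ψ : DetIso r E L) (ξ : DiffHom K L) {x : C}
    {s : Fin r → GenericStalk E} (hs : ∀ i, s i ∈ stalkAt K E x) :
    genericForm ψ ξ s ∈ regularAt K x := by
  obtain ⟨U, hU, t, ht, -⟩ := exists_common E x s hs
  have : genericForm ψ ξ s = localForm ψ ξ (generic_mem hU) t :=
    genericValue_germ ψ ξ _ t s ht
  rw [this]
  exact ξ.regular _ _ _ x hU

end GenericForm

/-! ### The sheaf `E(D)/E(-mD)` and its global sections -/

section Quotient

variable {C : Scheme.{u}} [IsIntegral C]

open Classical in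
/-- The stalk at `x` of the ideal sheaf of a reduced effective divisor, given as a finite set `D`
of closed points. -/
def idealAt (D : Set C) (x : C) : Ideal (C.presheaf.stalk x) :=
  if x ∈ D then IsLocalRing.maximalIdeal (C.presheaf.stalk x) else ⊤

variable (K : Type u) [Field K] [C.Over (Spec (CommRingCat.of K))]

/-- The stalk at `x` of `E(D)`, as a subspace of the generic stalk of `E`: the elements which are
multiplied into the stalk of `E` by the ideal of `D`. -/
def twist (E : C.Modules) (D : Set C) (x : C) : Submodule K (GenericStalk E) where
  carrier := {s | ∀ a ∈ idealAt D x,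
    algebraMap (C.presheaf.stalk x) C.functionField a • s ∈ stalkAt K E x}
  zero_mem' a _ := by rw [smul_zero]; exact zero_mem _
  add_mem' h h' a ha := by rw [smul_add]; exact add_mem (h a ha) (h' a ha)
  smul_mem' k s h a ha := by rw [smul_comm]; exact Submodule.smul_mem _ _ (h a ha)

/-- The stalk at `x` of `E(-mD)`, as a subspace of the generic stalk of `E`. -/
def negTwist (E : C.Modules) (D : Set C) (m : ℕ) (x : C) : Submodule K (GenericStalk E) :=
  Submodule.span K {s | ∃ a ∈ idealAt D x ^ m, ∃ e ∈ stalkAt K E x,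
    s = algebraMap (C.presheaf.stalk x) C.functionField a • e}

/-- The stalk at `x` of the quotient sheaf `E(D)/E(-mD)`. -/
abbrev QuotStalk (E : C.Modules) (D : Set C) (m : ℕ) (x : C) : Type u :=
  (twist K E D x) ⧸ (negTwist K E D m x).comap (twist K E D x).subtype

/-- The space of global sections of the quotient sheaf `E(D)/E(-mD)`: families of elements of the
stalks which are locally induced by sections of `E(D)`. A section of `E(D)` over a nonempty open
set `U` is a rational section of `E` that lies in the stalk of `E(D)` at every point of `U`. -/
def quotSections (E : C.Modules) (D : Set C) (m : ℕ) :
    Submodule K (∀ x : C, QuotStalk K E D m x) where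
  carrier := {q | ∀ x : C, ∃ U : C.Opens, x ∈ U ∧ ∃ s : GenericStalk E, ∀ y ∈ U,
    ∃ h : s ∈ twist K E D y, q y = Submodule.Quotient.mk ⟨s, h⟩}
  zero_mem' x := ⟨⊤, trivial, 0, fun y _ => ⟨zero_mem _, rfl⟩⟩
  add_mem' := by
    intro q q' hq hq' x
    obtain ⟨U, hU, s, hs⟩ := hq x
    obtain ⟨U', hU', s', hs'⟩ := hq' x
    refine ⟨U ⊓ U', ⟨hU, hU'⟩, s + s', fun y hy => ?_⟩
    obtain ⟨h, e⟩ := hs y hy.1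
    obtain ⟨h', e'⟩ := hs' y hy.2
    exact ⟨add_mem h h', by rw [Pi.add_apply, e, e']; rfl⟩
  smul_mem' := by
    intro k q hq x
    obtain ⟨U, hU, s, hs⟩ := hq x
    refine ⟨U, hU, k • s, fun y hy => ?_⟩
    obtain ⟨h, e⟩ := hs y hy
    exact ⟨Submodule.smul_mem _ k h, by rw [Pi.smul_apply, e]; rfl⟩

variable {K}

theorem stalkAt_le_twist (E : C.Modules) (D : Set C) (x : C) : stalkAt K E x ≤ twist K E D x :=
  fun _ hs a _ => IsSectionAt.smul hs a

theorem globalGerm_mem (E : C.Modules) (D : Set C) (x : C) (t : GlobalSections E) :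
    globalGerm (K := K) E t ∈ twist K E D x :=
  stalkAt_le_twist E D x ⟨⊤, trivial, t, rfl⟩

variable (K) in
/-- The natural map from global sections of `E` to global sections of `E(D)/E(-mD)`. -/
def toQuot (E : C.Modules) (D : Set C) (m : ℕ) :
    GlobalSections E →ₗ[K] quotSections K E D m where
  toFun t := ⟨fun x => Submodule.Quotient.mk ⟨globalGerm E t, globalGerm_mem E D x t⟩,
    fun _ => ⟨⊤, trivial, globalGerm E t, fun _ _ => ⟨_, rfl⟩⟩⟩
  map_add' t t' := by
    ext x
    simp only [map_add]
    rfl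
  map_smul' k t := by
    ext x
    simp only [map_smul]
    rfl

end Quotient

/-! ### The residue form -/

section Form

/-- An alternating form which vanishes as soon as one entry lies in `N` descends to the
quotient by `N`. -/
def descend {K M : Type*} [Field K] [AddCommGroup M] [Module K M] {r : ℕ}
    (f : M [⋀^Fin r]→ₗ[K] K) (N : Submodule K M) (h : ∀ s i, s i ∈ N → f s = 0) :
    (M ⧸ N) [⋀^Fin r]→ₗ[K] K :=
  have key : ∀ (s s' : Fin r → M), (∀ i, N.mkQ (s i) = N.mkQ (s' i)) → f s = f s' := by
    intro s s' hs
    classical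
    have H : ∀ T : Finset (Fin r), f s = f (T.piecewise s' s) := by
      intro T
      induction T using Finset.induction_on with
      | empty => simp
      | insert i T hi ih =>
        rw [ih, Finset.piecewise_insert]
        have e : T.piecewise s' s =
            Function.update (T.piecewise s' s) i (s' i + (s i - s' i)) := by
          rw [add_sub_cancel]
          ext j
          rcases eq_or_ne j i with rfl | hj
          · simp [hi]
          · simp [hj]
        conv_lhs => rw [e]
        rw [f.map_update_add, h (Function.update (T.piecewise s' s) i (s i - s' i)) i, add_zero]
        rw [Function.update_self]
        exact (Submodule.Quotient.eq N).mp (hs i)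
    simpa using H Finset.univ
  have hout : ∀ q : M ⧸ N, N.mkQ q.out = q := fun q => Quotient.out_eq q
  { toFun := fun q => f fun i => (q i).out
    map_update_add' := by
      intro inst q i a b
      obtain rfl := Subsingleton.elim inst (instDecidableEqFin r)
      have : ∀ (c : M ⧸ N) (c' : M), N.mkQ c' = c → (f fun j => (Function.update q i c j).out) =
          f (Function.update (fun j => (q j).out) i c') := by
        intro c c' hc
        refine key _ _ fun j => ?_
        rcases eq_or_ne j i with rfl | hj
        · simp [hout, hc]
        · simp [hj]
      rw [this _ (a.out + b.out) (by rw [map_add, hout, hout]), this a _ (hout a),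
        this b _ (hout b), f.map_update_add]
    map_update_smul' := by
      intro inst q i c a
      obtain rfl := Subsingleton.elim inst (instDecidableEqFin r)
      have : ∀ (c : M ⧸ N) (c' : M), N.mkQ c' = c → (f fun j => (Function.update q i c j).out) =
          f (Function.update (fun j => (q j).out) i c') := by
        intro c c' hc
        refine key _ _ fun j => ?_
        rcases eq_or_ne j i with rfl | hj
        · simp [hout, hc]
        · simp [hj]
      rw [this _ (c • a.out) (by rw [map_smul, hout]), this a _ (hout a), f.map_update_smul]
    map_eq_zero_of_eq' := by
      intro q i j hij hne
      exact f.map_eq_zero_of_eq _ (by rw [hij]) hne }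

variable {C : Scheme.{u}} [IsIntegral C] {K : Type u} [Field K]
  [C.Over (Spec (CommRingCat.of K))] {r : ℕ} {E L : C.Modules}

theorem genericForm_smul_regular (ψ : DetIso r E L) (ξ : DiffHom K L) {D : Set C} {x : C}
    (T : Finset (Fin r)) : ∀ (s : Fin r → GenericStalk E) (a : C.presheaf.stalk x),
    (∀ i ∈ T, s i ∈ twist K E D x) → (∀ i ∉ T, s i ∈ stalkAt K E x) →
    a ∈ idealAt D x ^ T.card →
    algebraMap (C.presheaf.stalk x) C.functionField a • genericForm ψ ξ s ∈ regularAt K x := by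
  classical
  induction T using Finset.induction_on with
  | empty =>
    intro s a _ h _
    exact smul_mem_regularAt K a (genericForm_regular ψ ξ fun i => h i (by simp))
  | insert i T hi ih =>
    intro s a h1 h2 ha
    rw [Finset.card_insert_of_notMem hi, pow_succ] at ha
    refine Submodule.mul_induction_on ha (fun c hc b hb => ?_) (fun c d hc hd => ?_)
    · have e : genericForm ψ ξ (Function.update s i
          (algebraMap (C.presheaf.stalk x) C.functionField b • s i)) =
          algebraMap (C.presheaf.stalk x) C.functionField b • genericForm ψ ξ s := by
        rw [AlternatingMap.map_update_smul, Function.update_eq_self]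
      rw [map_mul, mul_smul, ← e]
      refine ih _ c (fun j hj => ?_) (fun j hj => ?_) hc
      · rw [Function.update_of_ne (ne_of_mem_of_not_mem hj hi)]
        exact h1 j (Finset.mem_insert_of_mem hj)
      · rcases eq_or_ne j i with rfl | hji
        · rw [Function.update_self]
          exact h1 j (Finset.mem_insert_self _ _) b hb
        · rw [Function.update_of_ne hji]
          exact h2 j (by simp [hji, hj])
    · rw [map_add, add_smul]
      exact add_mem hc hd

theorem genericForm_negTwist (ψ : DetIso r E L) (ξ : DiffHom K L) {D : Set C} {x : C}
    (s : Fin r → GenericStalk E) (i : Fin r) (hs : ∀ j, s j ∈ twist K E D x)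
    (hi : s i ∈ negTwist K E D (r - 1) x) : residue K x (genericForm ψ ξ s) = 0 := by
  classical
  let φ : GenericStalk E →ₗ[K] K := (residue K x) ∘ₗ
    (((genericForm ψ ξ).toMultilinearMap.toLinearMap s i).restrictScalars K)
  have hφ : ∀ e, φ e = residue K x (genericForm ψ ξ (Function.update s i e)) := fun _ => rfl
  have : negTwist K E D (r - 1) x ≤ LinearMap.ker φ := by
    refine Submodule.span_le.mpr ?_
    rintro _ ⟨a, ha, e, he, rfl⟩
    rw [SetLike.mem_coe, LinearMap.mem_ker, hφ, AlternatingMap.map_update_smul]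
    refine residue_regular K x (genericForm_smul_regular ψ ξ (D := D) (Finset.univ.erase i) _ _
      (fun j hj => ?_) (fun j hj => ?_) ?_)
    · rw [Function.update_of_ne (Finset.ne_of_mem_erase hj)]
      exact hs j
    · obtain rfl : j = i := by simpa using hj
      rw [Function.update_self]
      exact he
    · rwa [Finset.card_erase_of_mem (Finset.mem_univ i), Finset.card_univ, Fintype.card_fin]
  have h0 := this hi
  rwa [LinearMap.mem_ker, hφ, Function.update_eq_self] at h0

/-- The form `ξ ∘ ψ` restricted to the stalk at `x` of `E(D)`, as an alternating form over the
ground field. -/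
def twistForm (ψ : DetIso r E L) (ξ : DiffHom K L) (D : Set C) (x : C) :
    twist K E D x [⋀^Fin r]→ₗ[K] Ω[C.functionField⁄K] where
  toMultilinearMap := ((genericForm ψ ξ).toMultilinearMap.restrictScalars K).compLinearMap
    fun _ => (twist K E D x).subtype
  map_eq_zero_of_eq' s _ _ hij hne :=
    (genericForm ψ ξ).map_eq_zero_of_eq (fun l => (s l : GenericStalk E))
      (congrArg Subtype.val hij) hne

/-- The summand `res_x (ξ ∘ ψ)(s₁ ∧ ⋯ ∧ sᵣ)` of the residue form, on the stalk at `x` of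
`E(D)/E(-(r-1)D)`, computed with arbitrary representatives in `E(D)`. -/
def residueFormAt (ψ : DetIso r E L) (ξ : DiffHom K L) (D : Set C) (x : C) :
    QuotStalk K E D (r - 1) x [⋀^Fin r]→ₗ[K] K :=
  descend
    ((residue K x).compAlternatingMap (twistForm ψ ξ D x))
    ((negTwist K E D (r - 1) x).comap (twist K E D x).subtype)
    (fun s i hi => genericForm_negTwist ψ ξ (D := D) (fun j => (s j : GenericStalk E)) i
      (fun j => (s j).2) hi)

/-- The alternating `r`-linear form on the global sections of `E(D)/E(-(r-1)D)`, where `D` is the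
sum of the distinct points `p i`: the sum over `i` of
`res_{p i} (ξ ∘ ψ)(s₁ ∧ ⋯ ∧ sᵣ)`. -/
def residueForm {N : ℕ} (ψ : DetIso r E L) (ξ : DiffHom K L) (p : Fin N → C) :
    quotSections K E (Set.range p) (r - 1) [⋀^Fin r]→ₗ[K] K :=
  ∑ i, (residueFormAt ψ ξ (Set.range p) (p i)).compLinearMap
    (LinearMap.proj (p i) ∘ₗ (quotSections K E (Set.range p) (r - 1)).subtype)

/-- A subspace `W` is degenerate for an alternating `r`-linear form if the form vanishes whenever
`r - 1` of its entries lie in `W`, the remaining entry being arbitrary. -/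
def IsDegenerate {Q : Type*} [AddCommMonoid Q] [Module K Q] (B : Q [⋀^Fin r]→ₗ[K] K)
    (W : Submodule K Q) : Prop :=
  ∀ (i₀ : Fin r) (s : Fin r → Q), (∀ i, i ≠ i₀ → s i ∈ W) → B s = 0

end Form

/-- The `K`-point of `C` underlying a morphism from the spectrum of the field `K`. -/
def point {C : Scheme.{u}} {K : Type u} [Field K] (P : Spec (CommRingCat.of K) ⟶ C) : C :=
  P (IsLocalRing.closedPoint K)

end CurveForms

end

/-!
Why the theorem holds. Let `W ⊆ V` be degenerate and take `w₂, …, wᵣ` in `W`. Inserting the section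
of `E(D)/E(-(r-1)D)` which is `t⁻¹ e` at a point `P` of the divisor and zero elsewhere, with `t` a
local parameter and `e` a local section of `E`, shows that the residue of
`t⁻¹ ξ (ψ (e ∧ w₂ ∧ ⋯ ∧ wᵣ))` at `P` is zero. Hence the regular differential
`ξ (ψ (e ∧ w₂ ∧ ⋯ ∧ wᵣ))` vanishes at every point of the divisor
(`IsEtaleCoordinate.exists_genericForm_eq_of_isDegenerate`).

On the other hand these differentials, for `e` in a local frame and `wᵢ` in `V`, lie in a finite
dimensional space, and a nonzero member of such a space has a bounded number of rational zeros. No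
degree theory is needed for this. The curve is covered by finitely many affine open sets
`U = Spec A` which are étale over the affine line with coordinate `x`; multiplication by `f` on the
function field, which is finite over `K(x)`, has a determinant which is a polynomial in `x` of
bounded degree, up to a fixed denominator, and which vanishes below the zeros of `f`
(`exists_polynomial_root`). The number of rational points of `U` over a given value of `x` is bounded
as well (`exists_card_fiber_le`).

Thus, if there are many points, `e ∧ w₂ ∧ ⋯ ∧ wᵣ = 0` at the generic point for all `e`, and any
`r - 1` elements of `W` are linearly dependent over the function field
(`exists_bound_not_linearIndependent`). For `r = 1` this is absurd, since the empty family is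
independent. For `r ≥ 2` the subspace `W` spans at the generic point a space of dimension at most
`r - 2`. It is contained in a space `H` of dimension `r - 2`, and the sections of `E` with generic
germ in `H` form a subbundle (`saturatedSubbundle`): the local rings of the curve are principal ideal
domains, so that `H` contains part of a basis of every stalk of `E`. This contradicts the hypothesis
on `V`.

The étale coordinate `x` also provides what is needed about differentials: `dx` generates them, and
`x - x(P)` is a local parameter at a rational point `P`, whence the residue at `P` exists
(`IsEtaleCoordinate.exists_isResidueAt`).
-/

namespace CurveForms

/-! ### A uniform bound for the number of zeros -/

section Zeros

open Polynomial

theorem natDegree_det_le_of_entries {R ι : Type*} [CommRing R] [Fintype ι] [DecidableEq ι]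
    (M : Matrix ι ι R[X]) (d : ℕ) (h : ∀ i j, (M i j).natDegree ≤ d) :
    M.det.natDegree ≤ Fintype.card ι * d := by
  rw [Matrix.det_apply]
  refine natDegree_sum_le_of_forall_le _ _ fun σ _ => ?_
  refine (natDegree_smul_le _ _).trans ((natDegree_prod_le _ _).trans ?_)
  refine (Finset.sum_le_card_nsmul _ _ d fun i _ => h _ _).trans ?_
  simp

/-- A primitive polynomial over `K[X]` stays nonzero when `X` is given a value in `K`. -/
theorem map_evalRingHom_ne_zero_of_isPrimitive {K : Type*} [Field K] {p : K[X][X]}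
    (hp : p.IsPrimitive)
    (a : K) : p.map (evalRingHom a) ≠ 0 := by
  intro h
  have hdvd : C (X - C a) ∣ p := by
    rw [C_dvd_iff_dvd_coeff]
    intro i
    rw [dvd_iff_isRoot]
    have := congrArg (fun q => q.coeff i) h
    simpa using this
  exact not_isUnit_X_sub_C a (hp _ hdvd)

theorem exists_isPrimitive_aeval_eq_zero {K A : Type*} [Field K] [CommRing A] [IsDomain A]
    [Algebra K[X] A] [FaithfulSMul K[X] A] {y : A} (hy : IsAlgebraic K[X] y) :
    ∃ p : K[X][X], p.IsPrimitive ∧ aeval y p = 0 := by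
  classical
  obtain ⟨p, hp, hpy⟩ := hy
  let : NormalizedGCDMonoid K[X] := Classical.choice inferInstance
  refine ⟨p.primPart, p.isPrimitive_primPart, ?_⟩
  rw [p.eq_C_content_mul_primPart, map_mul, aeval_C, mul_eq_zero] at hpy
  refine hpy.resolve_left fun h => hp ?_
  rw [← content_eq_zero_iff]
  exact (FaithfulSMul.algebraMap_eq_zero_iff K[X] A).mp h

variable {K A : Type*} [Field K] [CommRing A] [Algebra K A]

/-- The rational points of a finitely generated algebra over `K[X]` which is algebraic over `K[X]`
lie over any given point of the line in uniformly bounded number: a generator `y` of the algebra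
satisfies a primitive equation, which stays nonzero at each value of `X`. -/
theorem exists_card_fiber_le [IsDomain A] [Algebra.FiniteType K A] [Algebra K[X] A]
    [IsScalarTower K K[X] A] [FaithfulSMul K[X] A] [Algebra.IsAlgebraic K[X] A] :
    ∃ B : ℕ, ∀ (a : K) (S : Finset (A →ₐ[K] K)),
      (∀ v ∈ S, v (algebraMap K[X] A X) = a) → S.card ≤ B := by
  classical
  obtain ⟨G, hG⟩ := Algebra.FiniteType.out (R := K) (A := A)
  choose p hp hpy using fun y : G =>
    exists_isPrimitive_aeval_eq_zero (Algebra.IsAlgebraic.isAlgebraic (R := K[X]) (y : A))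
  refine ⟨∏ y, (p y).natDegree, fun a S hS => ?_⟩
  let T : Finset (G → K) :=
    Fintype.piFinset fun y => ((p y).map (evalRingHom a)).roots.toFinset
  have hT : T.card ≤ ∏ y, (p y).natDegree := by
    rw [Fintype.card_piFinset]
    exact Finset.prod_le_prod' fun y _ => (Multiset.toFinset_card_le _).trans
      ((card_roots' _).trans natDegree_map_le)
  refine le_trans (Finset.card_le_card_of_injOn (t := T) (fun v y => v y) (fun v hv => ?_) ?_) hT
  · simp only [T, Finset.mem_coe, Fintype.mem_piFinset, Multiset.mem_toFinset]
    intro y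
    rw [mem_roots (map_evalRingHom_ne_zero_of_isPrimitive (hp y) a), IsRoot.def, Polynomial.eval_map]
    have e : (v : A →+* K).comp (algebraMap K[X] A) = evalRingHom a := by
      ext
      · simp only [RingHom.comp_apply, coe_evalRingHom, eval_C]
        change v (algebraMap K[X] A (algebraMap K K[X] _)) = _
        rw [← IsScalarTower.algebraMap_apply, AlgHom.commutes]
        rfl
      · simpa using hS v hv
    have := congrArg (v : A →+* K) (hpy y)
    rw [aeval_def, hom_eval₂, e, map_zero] at this
    exact this
  · intro v _ w _ h
    refine AlgHom.ext_of_adjoin_eq_top hG fun y hy => congrFun h ⟨y, hy⟩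

/-- `f`, an element of the fraction field of `A`, vanishes at the rational point `v` of `A`: it is a
quotient `a / s` of elements of `A` such that `s` does not vanish at `v`, while `a` does. -/
def VanishesAt (L : Type*) [Field L] [Algebra A L] (v : A →ₐ[K] K) (f : L) : Prop :=
  ∃ a s : A, v s ≠ 0 ∧ v a = 0 ∧ f * algebraMap A L s = algebraMap A L a

/-- A nonzero function in a finite dimensional space has a multiple by a regular function which is
a nonzero polynomial in `X` of bounded degree, namely a multiple of the determinant of the
multiplication by the function. The zeros of the function lie over those of the polynomial. -/
theorem exists_polynomial_root (L F : Type*) [Field L] [Field F] [Algebra A L] [IsFractionRing A L]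
    [IsDomain A] [Algebra K[X] A] [IsScalarTower K K[X] A] [FaithfulSMul K[X] A]
    [Algebra K[X] F] [IsFractionRing K[X] F] [Algebra F L] [FiniteDimensional F L]
    [Algebra K[X] L] [IsScalarTower K[X] F L] [IsScalarTower K[X] A L]
    [Algebra K L] [IsScalarTower K K[X] L]
    (V : Submodule K L) [FiniteDimensional K V] :
    ∃ D : ℕ, ∀ f ∈ V, f ≠ 0 → ∃ q : K[X], q ≠ 0 ∧ q.natDegree ≤ D ∧
      ∀ v : A →ₐ[K] K, VanishesAt L v f → q.eval (v (algebraMap K[X] A X)) = 0 := by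
  classical
  have hinjA : Function.Injective (algebraMap A L) := IsFractionRing.injective A L
  have hinjF : Function.Injective (algebraMap K[X] F) := IsFractionRing.injective K[X] F
  -- a basis of the function field which consists of regular functions
  obtain ⟨b, e, hb⟩ : ∃ (b : Module.Basis (Fin (Module.finrank F L)) F L)
      (e : Fin (Module.finrank F L) → A), ∀ i, b i = algebraMap A L (e i) := by
    let b₀ := Module.finBasis F L
    obtain ⟨s, hs⟩ := IsLocalization.exist_integer_multiples (nonZeroDivisors A) Finset.univ b₀
    choose e he using fun i => hs i (Finset.mem_univ i)
    have hs0 : algebraMap A L (s : A) ≠ 0 := by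
      rw [Ne, map_eq_zero_iff _ hinjA]
      exact nonZeroDivisors.ne_zero s.2
    refine ⟨b₀.map (DistribMulAction.toLinearEquiv F L (Units.mk0 _ hs0)), e, fun i => ?_⟩
    rw [he]
    simp [Units.smul_def, Algebra.smul_def]
  obtain ⟨ι, v, hι, hv⟩ : ∃ (ι : Type) (v : ι → L) (_ : Finite ι),
      V = Submodule.span K (Set.range v) := by
    refine ⟨_, fun i => (Module.finBasis K V i : L), inferInstance, ?_⟩
    have := congrArg (Submodule.map V.subtype) (Module.finBasis K V).span_eq
    rw [Submodule.map_top, Submodule.range_subtype, Submodule.map_span, ← Set.range_comp] at this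
    exact this.symm
  have := Fintype.ofFinite ι
  -- a common denominator `g` of the matrices of multiplication
  obtain ⟨g, hg⟩ := IsLocalization.exist_integer_multiples (nonZeroDivisors K[X]) Finset.univ
    (fun x : ι × Fin (Module.finrank F L) × Fin (Module.finrank F L) =>
      Algebra.leftMulMatrix b (v x.1) x.2.1 x.2.2)
  have hg0 : (g : K[X]) ≠ 0 := nonZeroDivisors.ne_zero g.2
  choose c hc using fun x => hg x (Finset.mem_univ x)
  let D := Finset.univ.sup fun x => (c x).natDegree
  have key : ∀ f ∈ V, ∀ i j, ∃ p : K[X], p.natDegree ≤ D ∧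
      algebraMap K[X] F p = (g : K[X]) • Algebra.leftMulMatrix b f i j := by
    intro f hf i j
    rw [hv] at hf
    induction hf using Submodule.span_induction with
    | mem f hf =>
      obtain ⟨l, rfl⟩ := hf
      exact ⟨c (l, i, j), Finset.le_sup (f := fun x => (c x).natDegree) (Finset.mem_univ _),
        hc (l, i, j)⟩
    | zero => exact ⟨0, by simp, by simp⟩
    | add x y _ _ hx hy =>
      obtain ⟨p, hp, hp'⟩ := hx
      obtain ⟨q, hq, hq'⟩ := hy
      exact ⟨p + q, (natDegree_add_le _ _).trans (max_le hp hq), by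
        rw [map_add, hp', hq', map_add, Matrix.add_apply, smul_add]⟩
    | smul k x _ hx =>
      obtain ⟨p, hp, hp'⟩ := hx
      refine ⟨C k * p, (natDegree_C_mul_le _ _).trans hp, ?_⟩
      have : k • x = algebraMap K[X] F (C k) • x := by
        rw [Algebra.smul_def (algebraMap K[X] F (C k)), ← IsScalarTower.algebraMap_apply,
          ← Polynomial.algebraMap_eq, ← IsScalarTower.algebraMap_apply, Algebra.smul_def]
      rw [map_mul, hp', this, map_smul, Matrix.smul_apply, smul_eq_mul, mul_smul_comm]
  -- `h` is the denominator in an expression of `1` in the basis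
  obtain ⟨h, hh⟩ := IsLocalization.exist_integer_multiples (nonZeroDivisors K[X]) Finset.univ
    (fun i => b.repr 1 i)
  have hh0 : (h : K[X]) ≠ 0 := nonZeroDivisors.ne_zero h.2
  choose u hu using fun i => hh i (Finset.mem_univ i)
  have hone : algebraMap K[X] A h = ∑ i, algebraMap K[X] A (u i) * e i := by
    apply hinjA
    have := congrArg (fun z => (h : K[X]) • z) (b.sum_repr 1)
    simp only [Finset.smul_sum] at this
    rw [map_sum, ← IsScalarTower.algebraMap_apply, Algebra.algebraMap_eq_smul_one, ← this]
    refine Finset.sum_congr rfl fun i _ => ?_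
    rw [map_mul, ← IsScalarTower.algebraMap_apply, ← hb, ← smul_assoc, ← hu i,
      IsScalarTower.algebraMap_apply K[X] F L, Algebra.smul_def]
  refine ⟨Module.finrank F L * D + (h : K[X]).natDegree, fun f hf hf0 => ?_⟩
  choose P hPD hP using key f hf
  refine ⟨(Matrix.of P).det * h, mul_ne_zero (fun h0 => ?_) hh0, ?_, ?_⟩
  · have h1 : (Matrix.of P).map (algebraMap K[X] F) =
        algebraMap K[X] F g • Algebra.leftMulMatrix b f := by
      ext i j
      rw [Matrix.map_apply, Matrix.of_apply, hP, Matrix.smul_apply, algebraMap_smul]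
    have h2 := congrArg (algebraMap K[X] F) h0
    rw [RingHom.map_det, RingHom.mapMatrix_apply, h1, Matrix.det_smul, ← Algebra.norm_eq_matrix_det,
      map_zero, mul_eq_zero] at h2
    rcases h2 with h2 | h2
    · exact pow_ne_zero _ (fun h3 => hg0 ((map_eq_zero_iff _ hinjF).mp h3)) h2
    · exact Algebra.norm_ne_zero_iff.mpr hf0 h2
  · refine natDegree_mul_le.trans (Nat.add_le_add_right ?_ _)
    simpa using natDegree_det_le_of_entries (Matrix.of P) D hPD
  · rintro w ⟨a, s, hs, ha, hfa⟩
    -- the matrix identity `e P = g f e`, with the denominator `s` of `f` cleared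
    have hrow : ∀ j, s * ∑ i, e i * algebraMap K[X] A (P i j) =
        algebraMap K[X] A g * a * e j := by
      intro j
      apply hinjA
      have h1 : f * b j = ∑ i, Algebra.leftMulMatrix b f i j • b i := by
        conv_lhs => rw [← b.sum_repr (f * b j)]
        simp [Algebra.leftMulMatrix_eq_repr_mul]
      have h2 : algebraMap A L (∑ i, e i * algebraMap K[X] A (P i j)) =
          algebraMap K[X] L g * (f * b j) := by
        rw [h1, map_sum, Finset.mul_sum]
        refine Finset.sum_congr rfl fun i _ => ?_
        rw [map_mul, ← hb, ← IsScalarTower.algebraMap_apply, IsScalarTower.algebraMap_apply K[X] F L,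
          hP, Algebra.smul_def, Algebra.smul_def, map_mul, ← IsScalarTower.algebraMap_apply]
        ring
      rw [map_mul, h2, map_mul, map_mul, ← hfa, ← hb, ← IsScalarTower.algebraMap_apply]
      ring
    let Q : Matrix _ _ A := (Matrix.of P).map (algebraMap K[X] A)
    have hQ : ∀ i j, Q i j = algebraMap K[X] A (P i j) := fun _ _ => rfl
    have hdet : ∀ j, w (algebraMap K[X] A (Matrix.of P).det * e j) = 0 := by
      intro j
      have h1 : s • (Matrix.vecMul e Q) = (algebraMap K[X] A g * a) • e := by
        ext j
        simpa [Matrix.vecMul, dotProduct, hQ] using hrow j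
      have h2 := congrArg (fun z => Matrix.vecMul z Q.adjugate j) h1
      simp only [Matrix.smul_vecMul, Matrix.vecMul_vecMul, Matrix.mul_adjugate, Matrix.vecMul_smul,
        Matrix.vecMul_one, Pi.smul_apply, smul_eq_mul] at h2
      have h3 := congrArg w h2
      have h4 : Q.det = algebraMap K[X] A (Matrix.of P).det := by
        rw [RingHom.map_det, RingHom.mapMatrix_apply]
      rw [h4] at h3
      rw [map_mul w s, map_mul w (_ * a), map_mul w _ a, ha, mul_zero, zero_mul] at h3
      exact (mul_eq_zero.mp h3).resolve_left hs
    have h5 : ∀ p : K[X], w (algebraMap K[X] A p) = p.eval (w (algebraMap K[X] A X)) := by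
      intro p
      have := Polynomial.aeval_algHom_apply (w.comp (IsScalarTower.toAlgHom K K[X] A)) X p
      simp only [aeval_X_left, AlgHom.coe_id, id] at this
      simpa [coe_aeval_eq_eval] using this.symm
    rw [← h5, map_mul, hone, Finset.mul_sum, map_sum]
    refine Finset.sum_eq_zero fun i _ => ?_
    rw [mul_left_comm, map_mul, hdet, mul_zero]

/-- A nonzero function in a finite dimensional space of rational functions on an affine curve has a
bounded number of rational zeros. -/
theorem exists_card_zeros_le (L F : Type*) [Field L] [Field F] [Algebra A L] [IsFractionRing A L]
    [IsDomain A] [Algebra.FiniteType K A] [Algebra K[X] A] [IsScalarTower K K[X] A]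
    [FaithfulSMul K[X] A] [Algebra K[X] F] [IsFractionRing K[X] F] [Algebra F L]
    [FiniteDimensional F L] [Algebra K[X] L] [IsScalarTower K[X] F L] [IsScalarTower K[X] A L]
    [Algebra K L] [IsScalarTower K K[X] L] (V : Submodule K L) [FiniteDimensional K V] :
    ∃ N : ℕ, ∀ f ∈ V, f ≠ 0 → ∀ S : Finset (A →ₐ[K] K), (∀ v ∈ S, VanishesAt L v f) →
      S.card ≤ N := by
  classical
  have : Algebra.IsAlgebraic K[X] A := by
    refine ⟨fun y => ?_⟩
    have h : IsAlgebraic F (algebraMap A L y) := Algebra.IsAlgebraic.isAlgebraic _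
    rw [← IsFractionRing.isAlgebraic_iff K[X] F L] at h
    exact (isAlgebraic_algebraMap_iff (IsFractionRing.injective A L)).mp h
  obtain ⟨B, hB⟩ := exists_card_fiber_le (K := K) (A := A)
  obtain ⟨D, hD⟩ := exists_polynomial_root (A := A) L F V
  refine ⟨B * D, fun f hf hf0 S hS => ?_⟩
  obtain ⟨q, hq0, hqD, hq⟩ := hD f hf hf0
  refine (Finset.card_le_mul_card_image (f := fun v : A →ₐ[K] K => v (algebraMap K[X] A X)) S B
    fun a _ => hB a _ fun v hv => (Finset.mem_filter.mp hv).2).trans ?_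
  refine Nat.mul_le_mul_left _ (le_trans (Finset.card_le_card ?_)
    ((Multiset.toFinset_card_le _).trans ((card_roots' q).trans hqD)))
  intro a ha
  obtain ⟨v, hv, rfl⟩ := Finset.mem_image.mp ha
  rw [Multiset.mem_toFinset, mem_roots hq0]
  exact hq v (hS v hv)

end Zeros

/-! ### Étale algebras over the affine line -/

section EtaleLine

open Polynomial

variable (K : Type*) [Field K] (S : Type*) [CommRing S] [Algebra K[X] S]

/-- An étale algebra over `K[X]` is flat, so that `K[X]` embeds into it. -/
theorem faithfulSMul_of_etale [Nontrivial S] [Algebra.Etale K[X] S] : FaithfulSMul K[X] S := by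
  have : Module.Flat K[X] S := Algebra.Smooth.flat_of_isNoetherianRing K[X] S
  rw [faithfulSMul_iff_algebraMap_injective, injective_iff_map_eq_zero]
  intro p hp
  by_contra h0
  have h := Module.Flat.isSMulRegular_of_nonZeroDivisors (M := S) (mem_nonZeroDivisors_of_ne_zero h0)
  refine one_ne_zero (α := S) (h ?_)
  simp [Algebra.smul_def, hp]

/-- An unramified field extension of `K[X]` which is essentially of finite type is finite over the
field of rational functions. -/
theorem finite_fractionRing_of_unramified (F L : Type*) [Field F] [Field L] [Algebra K[X] F]
    [Algebra K[X] L] [Algebra F L] [IsScalarTower K[X] F L]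
    [Algebra.FormallyUnramified K[X] L] [Algebra.EssFiniteType K[X] L] : FiniteDimensional F L := by
  have : Algebra.FormallyUnramified F L := .of_restrictScalars K[X] F L
  have : Algebra.EssFiniteType F L := .of_comp K[X] F L
  exact Algebra.FormallyUnramified.finite_of_free F L

section Local

variable [IsLocalRing S] [Algebra.FormallyUnramified K[X] S] [Algebra.EssFiniteType K[X] S]

/-- The maximal ideal of an unramified local algebra over `K[X]` is generated by its contraction to
`K[X]`. This is the corresponding fact for a local homomorphism of local rings, applied to the
localization of `K[X]` at the contraction. -/
theorem maximalIdeal_eq_map_under_of_unramified :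
    IsLocalRing.maximalIdeal S =
      ((IsLocalRing.maximalIdeal S).comap (algebraMap K[X] S)).map (algebraMap K[X] S) := by
  set q := (IsLocalRing.maximalIdeal S).comap (algebraMap K[X] S) with hq
  let R₀ := Localization.AtPrime q
  let f : R₀ →+* S := IsLocalization.lift (M := q.primeCompl) (g := algebraMap K[X] S)
    fun y => by
      by_contra hy
      exact y.2 ((IsLocalRing.mem_maximalIdeal _).mpr hy)
  let _ : Algebra R₀ S := f.toAlgebra
  have htower : IsScalarTower K[X] R₀ S := .of_algebraMap_eq fun p =>
    (IsLocalization.lift_eq (M := q.primeCompl) _ p).symm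
  have : Algebra.FormallyUnramified R₀ S := .of_restrictScalars K[X] R₀ S
  have : Algebra.EssFiniteType R₀ S := .of_comp K[X] R₀ S
  have hmap : (IsLocalRing.maximalIdeal R₀).map (algebraMap R₀ S) = q.map (algebraMap K[X] S) := by
    rw [← Localization.AtPrime.map_eq_maximalIdeal, Ideal.map_map,
      ← IsScalarTower.algebraMap_eq]
  have : IsLocalHom (algebraMap R₀ S) := by
    refine ((IsLocalRing.local_hom_TFAE (algebraMap R₀ S)).out 2 0).mp ?_
    rw [hmap]
    exact Ideal.map_comap_le
  rw [← hmap, Algebra.FormallyUnramified.map_maximalIdeal]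

/-- At a rational point `v` of an unramified local algebra over `K[X]`, the function `X - v(X)` is a
local parameter. -/
theorem maximalIdeal_eq_span_of_unramified [Algebra K S] [IsScalarTower K K[X] S] (v : S →ₐ[K] K) :
    IsLocalRing.maximalIdeal S =
      Ideal.span {algebraMap K[X] S X - algebraMap K S (v (algebraMap K[X] S X))} := by
  have hker : IsLocalRing.maximalIdeal S = RingHom.ker v := by
    have : (RingHom.ker v).IsMaximal := RingHom.ker_isMaximal_of_surjective v fun k =>
      ⟨algebraMap K S k, by simp⟩
    exact (IsLocalRing.eq_maximalIdeal this).symm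
  have hcomap : (IsLocalRing.maximalIdeal S).comap (algebraMap K[X] S) =
      Ideal.span {X - C (v (algebraMap K[X] S X))} := by
    rw [hker]
    ext p
    rw [Ideal.mem_span_singleton, dvd_iff_isRoot, Ideal.mem_comap, RingHom.mem_ker, IsRoot.def]
    have := Polynomial.aeval_algHom_apply (v.comp (IsScalarTower.toAlgHom K K[X] S)) X p
    simp only [aeval_X_left, AlgHom.coe_id, id] at this
    rw [coe_aeval_eq_eval] at this
    rw [iff_comm]
    exact Eq.congr_left this
  rw [maximalIdeal_eq_map_under_of_unramified K S, hcomap, Ideal.map_span, Set.image_singleton,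
    map_sub, ← Polynomial.algebraMap_eq, ← IsScalarTower.algebraMap_apply]

end Local

theorem isPrincipalIdealRing_of_unramified (K : Type*) [Field K] (S : Type*) [CommRing S]
    [Algebra K[X] S] [IsLocalRing S] [Algebra.FormallyUnramified K[X] S]
    [Algebra.EssFiniteType K[X] S] [IsDomain S] : IsPrincipalIdealRing S := by
  have : IsNoetherianRing S := Algebra.EssFiniteType.isNoetherianRing K[X] S
  refine ((tfae_of_isNoetherianRing_of_isLocalRing_of_isDomain S).out 0 4).mpr ?_
  obtain ⟨p, hp⟩ := (IsPrincipalIdealRing.principal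
    ((IsLocalRing.maximalIdeal S).comap (algebraMap K[X] S))).principal
  refine ⟨algebraMap K[X] S p, ?_⟩
  rw [maximalIdeal_eq_map_under_of_unramified K S, hp]
  simp [Ideal.submodule_span_eq, Ideal.map_span]

variable [Algebra K S] [IsScalarTower K K[X] S]

/-- The differential of `X` generates the differentials of an unramified algebra over `K[X]`. -/
theorem exists_smul_D_X [Algebra.FormallyUnramified K[X] S] (ω : Ω[S⁄K]) :
    ∃ g : S, ω = g • KaehlerDifferential.D K S (algebraMap K[X] S X) := by
  have hsurj : ω ∈ LinearMap.range (KaehlerDifferential.mapBaseChange K K[X] S) := by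
    rw [KaehlerDifferential.range_mapBaseChange, LinearMap.mem_ker]
    exact Subsingleton.elim _ _
  obtain ⟨z, rfl⟩ := hsurj
  induction z with
  | zero => exact ⟨0, by simp⟩
  | tmul a η =>
    obtain ⟨p, rfl⟩ := (KaehlerDifferential.polynomialEquiv K).symm.surjective η
    refine ⟨a * algebraMap K[X] S p, ?_⟩
    rw [KaehlerDifferential.mapBaseChange_tmul, KaehlerDifferential.polynomialEquiv_symm, map_smul,
      KaehlerDifferential.map_D, mul_smul, algebraMap_smul]
  | add x y hx hy =>
    obtain ⟨g, hg⟩ := hx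
    obtain ⟨h, hh⟩ := hy
    exact ⟨g + h, by rw [map_add, hg, hh, add_smul]⟩

theorem D_X_ne_zero [Nontrivial S] [Algebra.FormallyEtale K[X] S] :
    KaehlerDifferential.D K S (algebraMap K[X] S X) ≠ 0 := by
  intro h
  have h1 := KaehlerDifferential.tensorKaehlerEquivOfFormallyEtale_symm_D_algebraMap K K[X] S X
  rw [h, map_zero] at h1
  have h2 := congrArg (TensorProduct.rid K[X] S ∘
    (LinearMap.lTensor S (KaehlerDifferential.polynomialEquiv K).toLinearMap)) h1
  simp at h2

end EtaleLine

/-! ### Étale coordinates on a smooth curve -/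

section Coordinates

open Polynomial

variable {C : Scheme.{u}} (K : Type u) [Field K] [C.Over (Spec (CommRingCat.of K))]

/-- The homomorphism from the polynomial ring which sends the variable to the function `z`. -/
noncomputable def polyHom {U : C.Opens} (z : Γ(C, U)) : K[X] →+* Γ(C, U) :=
  eval₂RingHom ((C.presheaf.map (homOfLE (le_top : U ≤ ⊤)).op).hom.comp (const C K)) z

/-- `z` is an étale coordinate on the affine open set `U`: the morphism from `U` to the affine
line given by `z` is étale. -/
structure IsEtaleCoordinate {U : C.Opens} (z : Γ(C, U)) : Prop where
  isAffineOpen : IsAffineOpen U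
  etale : (polyHom K z).Etale

/-- A smooth curve is covered by domains of étale coordinates. -/
theorem exists_isEtaleCoordinate [SmoothOfRelativeDimension 1 (C ↘ Spec (CommRingCat.of K))]
    (x : C) : ∃ (U : C.Opens) (_ : x ∈ U) (z : Γ(C, U)), IsEtaleCoordinate K z := by
  obtain ⟨U₀, hU₀, U, hU, hx, e, hs⟩ :=
    SmoothOfRelativeDimension.exists_isStandardSmoothOfRelativeDimension
      (n := 1) (f := C ↘ Spec (CommRingCat.of K)) x
  obtain rfl : U₀ = ⊤ := by
    refine top_le_iff.mp fun y _ => ?_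
    have : y = (C ↘ Spec (CommRingCat.of K)) x := Subsingleton.elim (α := PrimeSpectrum K) _ _
    rw [this]
    exact e hx
  obtain ⟨g, hg, hge⟩ :=
    RingHom.IsStandardSmoothOfRelativeDimension.exists_etale_mvPolynomial hs
  let ε : K ≃+* Γ(Spec (CommRingCat.of K), ⊤) :=
    (Scheme.ΓSpecIso (CommRingCat.of K)).symm.commRingCatIsoToRingEquiv
  let δ : K[X] ≃+* MvPolynomial (Fin 1) Γ(Spec (CommRingCat.of K), ⊤) :=
    (Polynomial.mapEquiv ε).trans (MvPolynomial.uniqueAlgEquiv _ (Fin 1)).symm.toRingEquiv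
  refine ⟨U, hx, g (δ X), hU, ?_⟩
  have h := RingHom.Etale.respectsIso.2 g δ hge
  convert h using 1
  refine Polynomial.ringHom_ext (fun k => ?_) ?_
  · have h1 : δ (Polynomial.C k) = MvPolynomial.C (ε k) := by
      simp [δ]
    have h2 : g (MvPolynomial.C (ε k)) = ((C ↘ Spec (CommRingCat.of K)).appLE ⊤ U e).hom (ε k) :=
      RingHom.congr_fun hg _
    simp only [polyHom, coe_eval₂RingHom, eval₂_C]
    change _ = g (δ (Polynomial.C k))
    rw [h1, h2]
    rfl
  · simp [polyHom]

variable {K}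

theorem germ_res_const {U : C.Opens} {x : C} (hx : x ∈ U) (k : K) :
    C.presheaf.germ U x hx (C.presheaf.map (homOfLE (le_top : U ≤ ⊤)).op (const C K k)) =
      algebraMap K (C.presheaf.stalk x) k :=
  TopCat.Presheaf.germ_res_apply C.presheaf (homOfLE le_top) x hx _

variable (K) in
/-- The structure of a `K[X]`-algebra on the stalk at a point given by a regular function. -/
noncomputable abbrev stalkPolyAlgebra {U : C.Opens} (z : Γ(C, U)) {x : C} (hx : x ∈ U) :
    Algebra K[X] (C.presheaf.stalk x) :=
  ((C.presheaf.germ U x hx).hom.comp (polyHom K z)).toAlgebra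

theorem stalkPolyAlgebra_X {U : C.Opens} (z : Γ(C, U)) {x : C} (hx : x ∈ U) :
    letI := stalkPolyAlgebra K z hx
    algebraMap K[X] (C.presheaf.stalk x) X = C.presheaf.germ U x hx z := by
  change C.presheaf.germ U x hx (polyHom K z X) = _
  simp [polyHom]

theorem stalkPolyAlgebra_isScalarTower {U : C.Opens} (z : Γ(C, U)) {x : C} (hx : x ∈ U) :
    letI := stalkPolyAlgebra K z hx
    IsScalarTower K K[X] (C.presheaf.stalk x) := by
  let _ := stalkPolyAlgebra K z hx
  refine .of_algebraMap_eq fun k => ?_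
  change _ = C.presheaf.germ U x hx (polyHom K z (Polynomial.C k))
  rw [← germ_res_const hx k]
  simp [polyHom]

theorem mem_maximalIdeal_iff {x : C} (v : C.presheaf.stalk x →ₐ[K] K) (a : C.presheaf.stalk x) :
    a ∈ IsLocalRing.maximalIdeal (C.presheaf.stalk x) ↔ v a = 0 := by
  have : (RingHom.ker v).IsMaximal := RingHom.ker_isMaximal_of_surjective v fun k =>
    ⟨algebraMap K (C.presheaf.stalk x) k, by simp⟩
  rw [← IsLocalRing.eq_maximalIdeal this, RingHom.mem_ker]

theorem algebraMap_germ [IsIntegral C] {U : C.Opens} {x : C} (hx : x ∈ U) (a : Γ(C, U)) :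
    algebraMap (C.presheaf.stalk x) C.functionField (C.presheaf.germ U x hx a) =
      funGerm (generic_mem hx) a :=
  ConcreteCategory.congr_hom
    (C.presheaf.germ_stalkSpecializes hx ((genericPoint_spec C).specializes trivial)) a

namespace IsEtaleCoordinate

variable {U : C.Opens} {z : Γ(C, U)} (hz : IsEtaleCoordinate K z) {x : C} (hx : x ∈ U)

include hz

theorem formallyEtale_stalk :
    letI := stalkPolyAlgebra K z hx
    Algebra.FormallyEtale K[X] (C.presheaf.stalk x) := by
  let _ : Algebra K[X] Γ(C, U) := (polyHom K z).toAlgebra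
  let _ := TopCat.Presheaf.algebra_section_stalk C.presheaf (⟨x, hx⟩ : U)
  let _ := stalkPolyAlgebra K z hx
  have : IsScalarTower K[X] Γ(C, U) (C.presheaf.stalk x) := .of_algebraMap_eq' rfl
  have : Algebra.Etale K[X] Γ(C, U) := hz.etale
  have : IsLocalization.AtPrime (C.presheaf.stalk x) _ :=
    hz.isAffineOpen.isLocalization_stalk ⟨x, hx⟩
  have : Algebra.FormallyEtale Γ(C, U) (C.presheaf.stalk x) :=
    .of_isLocalization (hz.isAffineOpen.primeIdealOf ⟨x, hx⟩).asIdeal.primeCompl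
  exact Algebra.FormallyEtale.comp K[X] Γ(C, U) _

theorem essFiniteType_stalk :
    letI := stalkPolyAlgebra K z hx
    Algebra.EssFiniteType K[X] (C.presheaf.stalk x) := by
  let _ : Algebra K[X] Γ(C, U) := (polyHom K z).toAlgebra
  let _ := TopCat.Presheaf.algebra_section_stalk C.presheaf (⟨x, hx⟩ : U)
  let _ := stalkPolyAlgebra K z hx
  have : IsScalarTower K[X] Γ(C, U) (C.presheaf.stalk x) := .of_algebraMap_eq' rfl
  have : Algebra.Etale K[X] Γ(C, U) := hz.etale
  have : IsLocalization.AtPrime (C.presheaf.stalk x) _ :=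
    hz.isAffineOpen.isLocalization_stalk ⟨x, hx⟩
  have : Algebra.EssFiniteType Γ(C, U) (C.presheaf.stalk x) :=
    .of_isLocalization _ (hz.isAffineOpen.primeIdealOf ⟨x, hx⟩).asIdeal.primeCompl
  exact Algebra.EssFiniteType.comp K[X] Γ(C, U) _

/-- At a rational point the coordinate, minus its value, is a local parameter. -/
theorem maximalIdeal_eq_span (v : C.presheaf.stalk x →ₐ[K] K) :
    IsLocalRing.maximalIdeal (C.presheaf.stalk x) =
      Ideal.span {C.presheaf.germ U x hx z -
        algebraMap K (C.presheaf.stalk x) (v (C.presheaf.germ U x hx z))} := by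
  let _ := stalkPolyAlgebra K z hx
  have := stalkPolyAlgebra_isScalarTower (K := K) z hx
  have := hz.formallyEtale_stalk hx
  have := hz.essFiniteType_stalk hx
  have h := maximalIdeal_eq_span_of_unramified K (C.presheaf.stalk x) v
  rwa [stalkPolyAlgebra_X] at h

variable [IsIntegral C]

/-- The local rings of a smooth curve are principal ideal domains. -/
theorem isPrincipalIdealRing_stalk {y : C} (hy : y ∈ U) :
    IsPrincipalIdealRing (C.presheaf.stalk y) := by
  let _ := stalkPolyAlgebra K z hy
  have := hz.formallyEtale_stalk hy
  have := hz.essFiniteType_stalk hy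
  exact isPrincipalIdealRing_of_unramified K _

theorem exists_smul_D (hU : genericPoint C ∈ U) (ω : Ω[C.functionField⁄K]) :
    ∃ g : C.functionField, ω = g • KaehlerDifferential.D K C.functionField (funGerm hU z) := by
  let _ := stalkPolyAlgebra K z hU
  have := stalkPolyAlgebra_isScalarTower (K := K) z hU
  have := hz.formallyEtale_stalk hU
  have h := exists_smul_D_X K (C.presheaf.stalk (genericPoint C)) ω
  rwa [stalkPolyAlgebra_X] at h

theorem D_ne_zero (hU : genericPoint C ∈ U) :
    KaehlerDifferential.D K C.functionField (funGerm hU z) ≠ 0 := by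
  let _ := stalkPolyAlgebra K z hU
  have := stalkPolyAlgebra_isScalarTower (K := K) z hU
  have := hz.formallyEtale_stalk hU
  have h := D_X_ne_zero K (C.presheaf.stalk (genericPoint C))
  rwa [stalkPolyAlgebra_X] at h

/-- The rational differentials are free of rank one over the function field, with the differential
of the coordinate as a generator. -/
noncomputable def differentialEquiv (hU : genericPoint C ∈ U) :
    C.functionField ≃ₗ[C.functionField] Ω[C.functionField⁄K] :=
  LinearEquiv.ofBijective (LinearMap.toSpanSingleton C.functionField Ω[C.functionField⁄K]
    (KaehlerDifferential.D K C.functionField (funGerm hU z)))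
    ⟨fun _ _ hab => smul_left_injective _ (hz.D_ne_zero hU) hab,
      fun ω => (hz.exists_smul_D hU ω).imp fun _ hg => hg.symm⟩

theorem differentialEquiv_symm_smul (hU : genericPoint C ∈ U) (g : C.functionField) :
    (hz.differentialEquiv hU).symm
      (g • KaehlerDifferential.D K C.functionField (funGerm hU z)) = g :=
  (hz.differentialEquiv hU).symm_apply_apply g

/-- The differentials regular at `x` are the multiples of the differential of the coordinate by
regular functions at `x`. -/
theorem exists_smul_D_of_mem_regularAt {ω : Ω[C.functionField⁄K]} (hω : ω ∈ regularAt K x) :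
    ∃ g : C.presheaf.stalk x, ω = algebraMap (C.presheaf.stalk x) C.functionField g •
      KaehlerDifferential.D K C.functionField (funGerm (generic_mem hx) z) := by
  let _ := stalkPolyAlgebra K z hx
  have := stalkPolyAlgebra_isScalarTower (K := K) z hx
  have := hz.formallyEtale_stalk hx
  obtain ⟨η, rfl⟩ := hω
  obtain ⟨g, rfl⟩ := exists_smul_D_X K (C.presheaf.stalk x) η
  refine ⟨g, ?_⟩
  rw [map_smul, KaehlerDifferential.map_D, stalkPolyAlgebra_X, algebraMap_smul]
  rw [algebraMap_germ]

/-- A nonzero function in a finite dimensional space of rational functions vanishes at a bounded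
number of rational points in the domain of an étale coordinate. -/
theorem exists_card_zeros_le (F₀ : Submodule K C.functionField) [FiniteDimensional K F₀] :
    ∃ N : ℕ, ∀ f ∈ F₀, f ≠ 0 → ∀ S : Finset C, (∀ x ∈ S, x ∈ U ∧
      Nonempty (C.presheaf.stalk x →ₐ[K] K) ∧
      ∃ a ∈ IsLocalRing.maximalIdeal (C.presheaf.stalk x),
        algebraMap (C.presheaf.stalk x) C.functionField a = f) → S.card ≤ N := by
  classical
  by_cases hne : (U : Set C).Nonempty
  swap
  · refine ⟨0, fun f _ _ S hS => ?_⟩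
    rw [Nat.le_zero, Finset.card_eq_zero, Finset.eq_empty_iff_forall_notMem]
    exact fun x hx => hne ⟨x, (hS x hx).1⟩
  have : Nonempty U := hne.to_subtype
  have hU : genericPoint C ∈ U := generic_mem hne.some_mem
  let _ : Algebra K[X] Γ(C, U) := (polyHom K z).toAlgebra
  let _ : Algebra K Γ(C, U) :=
    ((C.presheaf.map (homOfLE (le_top : U ≤ ⊤)).op).hom.comp (const C K)).toAlgebra
  have htower : IsScalarTower K K[X] Γ(C, U) := .of_algebraMap_eq fun k => by
    change _ = polyHom K z (Polynomial.C k)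
    simp only [polyHom, coe_eval₂RingHom, eval₂_C]
    rfl
  have : Algebra.Etale K[X] Γ(C, U) := hz.etale
  have : Algebra.FiniteType K Γ(C, U) := Algebra.FiniteType.trans (S := K[X]) inferInstance
    inferInstance
  have := faithfulSMul_of_etale K Γ(C, U)
  have : IsFractionRing Γ(C, U) C.functionField :=
    functionField_isFractionRing_of_isAffineOpen C U hz.isAffineOpen
  let _ : Algebra K[X] C.functionField := stalkPolyAlgebra K z hU
  have : IsScalarTower K K[X] C.functionField := stalkPolyAlgebra_isScalarTower (K := K) z hU
  have : IsScalarTower K[X] Γ(C, U) C.functionField := .of_algebraMap_eq' rfl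
  have : Algebra.FormallyEtale K[X] C.functionField := hz.formallyEtale_stalk hU
  have : Algebra.EssFiniteType K[X] C.functionField := hz.essFiniteType_stalk hU
  have : FaithfulSMul K[X] C.functionField := by
    rw [faithfulSMul_iff_algebraMap_injective, IsScalarTower.algebraMap_eq K[X] Γ(C, U)]
    exact (IsFractionRing.injective Γ(C, U) C.functionField).comp
      (FaithfulSMul.algebraMap_injective K[X] Γ(C, U))
  let _ : Algebra (FractionRing K[X]) C.functionField := FractionRing.liftAlgebra K[X] _
  have : FiniteDimensional (FractionRing K[X]) C.functionField :=
    finite_fractionRing_of_unramified K _ _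
  obtain ⟨N, hN⟩ := CurveForms.exists_card_zeros_le (A := Γ(C, U)) C.functionField
    (FractionRing K[X]) F₀
  refine ⟨N, fun f hf hf0 S hS => ?_⟩
  -- a rational point of `U` is an evaluation on the ring of functions
  choose hSU hSv hSz using hS
  let ev : ∀ x : S, Γ(C, U) →ₐ[K] K := fun x =>
    { (hSv x x.2).some.toRingHom.comp (C.presheaf.germ U x (hSU x x.2)).hom with
      commutes' := fun k => by
        change (hSv x x.2).some (C.presheaf.germ U x _ _) = _
        have := germ_res_const (hSU x x.2) k
        exact (congrArg (hSv x x.2).some this).trans ((hSv x x.2).some.commutes k) }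
  have hprime : ∀ x : S, RingHom.ker (ev x) =
      (hz.isAffineOpen.primeIdealOf ⟨x, hSU x x.2⟩).asIdeal := by
    intro x
    rw [IsAffineOpen.primeIdealOf_eq_map_closedPoint]
    ext a
    change (hSv x x.2).some (C.presheaf.germ U x _ a) = 0 ↔
      C.presheaf.germ U x _ a ∈ IsLocalRing.maximalIdeal _
    rw [mem_maximalIdeal_iff (hSv x x.2).some]
  have hinj : Function.Injective ev := by
    intro x y hxy
    have h1 := hprime x
    rw [hxy, hprime y] at h1
    have h2 := congrArg hz.isAffineOpen.fromSpec (PrimeSpectrum.ext h1)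
    rw [IsAffineOpen.fromSpec_primeIdealOf, IsAffineOpen.fromSpec_primeIdealOf] at h2
    exact Subtype.ext h2.symm
  have hcard := hN f hf hf0 (S.attach.map ⟨ev, hinj⟩) fun v hv => by
    obtain ⟨x, -, rfl⟩ := Finset.mem_map.mp hv
    obtain ⟨a, ha, rfl⟩ := hSz x x.2
    let _ := TopCat.Presheaf.algebra_section_stalk C.presheaf (⟨x, hSU x x.2⟩ : U)
    have := hz.isAffineOpen.isLocalization_stalk ⟨x, hSU x x.2⟩
    obtain ⟨⟨b, s⟩, hbs⟩ := IsLocalization.surj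
      (hz.isAffineOpen.primeIdealOf ⟨x, hSU x x.2⟩).asIdeal.primeCompl a
    have hs : (s : Γ(C, U)) ∉ RingHom.ker (ev x) := by
      rw [hprime]
      exact s.2
    have hbs' : a * C.presheaf.germ U x (hSU x x.2) s = C.presheaf.germ U x (hSU x x.2) b := hbs
    refine ⟨b, s, hs, ?_, ?_⟩
    · change (hSv x x.2).some (C.presheaf.germ U x _ b) = 0
      rw [← hbs', map_mul, (mem_maximalIdeal_iff (hSv x x.2).some a).mp ha, zero_mul]
    · have := congrArg (algebraMap (C.presheaf.stalk (x : C)) C.functionField) hbs'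
      rw [map_mul, Scheme.algebraMap_germ_eq_germToFunctionField,
        Scheme.algebraMap_germ_eq_germToFunctionField] at this
      exact this
  simpa using hcard

end IsEtaleCoordinate

end Coordinates

/-! ### Residues -/

section Residues

/-- The negative powers of a nonunit `t` of a local ring are independent modulo the ring. -/
theorem linearIndependent_mkQ_inv_pow {K R L : Type*} [Field K] [CommRing R] [IsLocalRing R]
    [Field L] [Algebra K R] [Algebra R L] [FaithfulSMul R L] [Algebra K L] [IsScalarTower K R L]
    {t : R} (ht : t ∈ IsLocalRing.maximalIdeal R) (ht0 : algebraMap R L t ≠ 0) :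
    LinearIndependent K fun j : ℕ =>
      (LinearMap.range (IsScalarTower.toAlgHom K R L).toLinearMap).mkQ
        ((algebraMap R L t ^ (j + 1))⁻¹) := by
  classical
  rw [linearIndependent_iff']
  intro s c hc
  by_contra! hne
  let s' := s.filter fun j => c j ≠ 0
  have hs' : s'.Nonempty := by
    obtain ⟨i, hi, hci⟩ := hne
    exact ⟨i, Finset.mem_filter.mpr ⟨hi, hci⟩⟩
  obtain ⟨m, hm, hmax⟩ : ∃ m ∈ s', ∀ j ∈ s', j ≤ m :=
    ⟨s'.max' hs', s'.max'_mem hs', fun j hj => s'.le_max' j hj⟩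
  have hsum : ∑ j ∈ s', c j • (algebraMap R L t ^ (j + 1))⁻¹ ∈
      LinearMap.range (IsScalarTower.toAlgHom K R L).toLinearMap := by
    rw [← Submodule.Quotient.mk_eq_zero, ← Submodule.mkQ_apply, map_sum, ← hc,
      Finset.sum_filter_of_ne]
    · simp
    · intro j _ hj h0
      exact hj (by simp [h0])
  obtain ⟨a, ha⟩ := hsum
  -- after multiplication by `t ^ (m + 1)` only the leading coefficient survives modulo `t`
  have hR : ∑ j ∈ s', algebraMap K R (c j) * t ^ (m - j) = a * t ^ (m + 1) := by
    apply FaithfulSMul.algebraMap_injective R L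
    rw [map_sum, map_mul, map_pow]
    have ha' : algebraMap R L a = ∑ j ∈ s', c j • (algebraMap R L t ^ (j + 1))⁻¹ := ha
    rw [ha', Finset.sum_mul]
    refine Finset.sum_congr rfl fun j hj => ?_
    have e : m + 1 = (m - j) + (j + 1) := by have := hmax j hj; omega
    rw [e, pow_add, map_mul, map_pow, ← IsScalarTower.algebraMap_apply, Algebra.smul_def]
    field_simp
    ring
  rw [← Finset.add_sum_erase _ _ hm, Nat.sub_self, pow_zero, mul_one] at hR
  have hmem : algebraMap K R (c m) ∈ IsLocalRing.maximalIdeal R := by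
    rw [eq_sub_of_add_eq hR]
    refine sub_mem (Ideal.mul_mem_left _ _ (Ideal.pow_mem_of_mem _ ht _ (by omega)))
      (sum_mem fun j hj => Ideal.mul_mem_left _ _ (Ideal.pow_mem_of_mem _ ht _ ?_))
    have h1 := Finset.ne_of_mem_erase hj
    have h2 := hmax j (Finset.mem_of_mem_erase hj)
    omega
  exact (IsLocalRing.mem_maximalIdeal _).mp hmem
    ((IsUnit.mk0 _ (Finset.mem_filter.mp hm).2).map (algebraMap K R))

variable {C : Scheme.{u}} [IsIntegral C] {K : Type u} [Field K] [C.Over (Spec (CommRingCat.of K))]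

theorem D_mem_regularAt (x : C) (a : C.presheaf.stalk x) :
    KaehlerDifferential.D K C.functionField (algebraMap (C.presheaf.stalk x) C.functionField a) ∈
      regularAt K x :=
  ⟨KaehlerDifferential.D K _ a, by rw [KaehlerDifferential.map_D]⟩

namespace IsEtaleCoordinate

variable {U : C.Opens} {z : Γ(C, U)} (hz : IsEtaleCoordinate K z) {x : C} (hx : x ∈ U)

include hz hx

/-- The residue exists at a rational point: the powers `t⁻¹, t⁻², …` of a local parameter are
linearly independent modulo the regular functions, so that there is a functional taking the
prescribed values. -/
theorem exists_isResidueAt (v : C.presheaf.stalk x →ₐ[K] K) :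
    ∃ ρ : Ω[C.functionField⁄K] →ₗ[K] K, IsResidueAt x ρ := by
  let t := C.presheaf.germ U x hx z -
    algebraMap K (C.presheaf.stalk x) (v (C.presheaf.germ U x hx z))
  have hspan : IsLocalRing.maximalIdeal (C.presheaf.stalk x) = Ideal.span {t} :=
    hz.maximalIdeal_eq_span hx v
  have hDt : KaehlerDifferential.D K C.functionField
      (algebraMap (C.presheaf.stalk x) C.functionField t) =
      KaehlerDifferential.D K C.functionField (funGerm (generic_mem hx) z) := by
    rw [map_sub, algebraMap_germ, ← IsScalarTower.algebraMap_apply, map_sub,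
      Derivation.map_algebraMap, sub_zero]
  have hD0 := hz.D_ne_zero (generic_mem hx)
  have ht0 : algebraMap (C.presheaf.stalk x) C.functionField t ≠ 0 := by
    intro h
    rw [h, map_zero] at hDt
    exact hD0 hDt.symm
  have : FaithfulSMul (C.presheaf.stalk x) C.functionField := by
    rw [faithfulSMul_iff_algebraMap_injective]
    exact IsFractionRing.injective _ _
  let R₀ := LinearMap.range (IsScalarTower.toAlgHom K (C.presheaf.stalk x)
    C.functionField).toLinearMap
  have hli := linearIndependent_mkQ_inv_pow (K := K) (L := C.functionField)
    (show t ∈ _ from hspan ▸ Ideal.mem_span_singleton_self t) ht0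
  obtain ⟨f, hf⟩ := LinearMap.exists_extend
    ((Module.Basis.span hli).constr K fun j : ℕ => if j = 0 then (1 : K) else 0)
  have hfj : ∀ j : ℕ, f (R₀.mkQ ((algebraMap _ C.functionField t ^ (j + 1))⁻¹)) =
      if j = 0 then 1 else 0 := by
    intro j
    have := LinearMap.congr_fun hf (Module.Basis.span hli j)
    rw [Module.Basis.constr_basis, LinearMap.comp_apply, Submodule.subtype_apply,
      Module.Basis.span_apply] at this
    exact this
  let ε := hz.differentialEquiv (generic_mem hx)
  refine ⟨f ∘ₗ R₀.mkQ ∘ₗ (ε.symm.restrictScalars K).toLinearMap, t, hspan, fun ω hω => ?_,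
    fun j => ?_⟩
  · obtain ⟨g, rfl⟩ := hz.exists_smul_D_of_mem_regularAt hx hω
    change f (R₀.mkQ (ε.symm _)) = 0
    rw [differentialEquiv_symm_smul]
    have : R₀.mkQ (algebraMap _ C.functionField g) = 0 :=
      (Submodule.Quotient.mk_eq_zero _).mpr ⟨g, rfl⟩
    rw [this, map_zero]
  · change f (R₀.mkQ (ε.symm _)) = _
    rw [hDt, differentialEquiv_symm_smul, hfj]

theorem isResidueAt_residue (v : C.presheaf.stalk x →ₐ[K] K) : IsResidueAt x (residue K x) := by
  have h := hz.exists_isResidueAt hx v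
  unfold residue
  rw [dif_pos h]
  exact h.choose_spec

/-- A regular differential vanishes at a rational point if its quotient by a local parameter
has no residue. -/
theorem exists_eq_smul_of_residue_eq_zero (v : C.presheaf.stalk x →ₐ[K] K)
    {ω : Ω[C.functionField⁄K]} (hω : ω ∈ regularAt K x)
    (h : ∀ t : C.presheaf.stalk x, IsLocalRing.maximalIdeal (C.presheaf.stalk x) = Ideal.span {t} →
      residue K x ((algebraMap _ C.functionField t)⁻¹ • ω) = 0) :
    ∃ a ∈ IsLocalRing.maximalIdeal (C.presheaf.stalk x),
      ω = algebraMap (C.presheaf.stalk x) C.functionField a •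
        KaehlerDifferential.D K C.functionField (funGerm (generic_mem hx) z) := by
  obtain ⟨t, hspan, hreg, hres⟩ := hz.isResidueAt_residue hx v
  have h1 : residue K x ((algebraMap _ C.functionField t)⁻¹ •
      KaehlerDifferential.D K C.functionField (algebraMap _ C.functionField t)) = 1 := by
    simpa using hres 0
  set τ := algebraMap (C.presheaf.stalk x) C.functionField t with hτ
  have hτ0 : τ ≠ 0 := by
    intro h0
    rw [h0, map_zero, smul_zero, map_zero] at h1
    exact zero_ne_one h1
  obtain ⟨g, hg⟩ := hz.exists_smul_D_of_mem_regularAt hx hω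
  obtain ⟨w, hw⟩ := hz.exists_smul_D_of_mem_regularAt hx (D_mem_regularAt (K := K) x t)
  rw [← hτ] at hw
  set dz := KaehlerDifferential.D K C.functionField (funGerm (generic_mem hx) z) with hdz
  -- `dt` is a generator, for otherwise `t⁻¹ dt` would be regular and have residue zero
  have hwu : IsUnit w := by
    by_contra hwu
    have hwm : w ∈ IsLocalRing.maximalIdeal (C.presheaf.stalk x) := hwu
    rw [hspan, Ideal.mem_span_singleton] at hwm
    obtain ⟨w', rfl⟩ := hwm
    have h2 : τ⁻¹ • KaehlerDifferential.D K C.functionField τ =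
        algebraMap (C.presheaf.stalk x) C.functionField w' • dz := by
      rw [hw, map_mul, smul_smul, ← mul_assoc, inv_mul_cancel₀ hτ0, one_mul]
    rw [h2, hdz, ← algebraMap_germ hx,
      hreg _ (smul_mem_regularAt K w' (D_mem_regularAt (K := K) x _))] at h1
    exact zero_ne_one h1
  obtain ⟨w, rfl⟩ := hwu
  have hω' : ω = algebraMap (C.presheaf.stalk x) C.functionField (g * ↑w⁻¹) •
      KaehlerDifferential.D K C.functionField τ := by
    rw [hg, hw, smul_smul, ← map_mul, Units.inv_mul_cancel_right]
  have hdec : g * ↑w⁻¹ - algebraMap K (C.presheaf.stalk x) (v (g * ↑w⁻¹)) ∈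
      IsLocalRing.maximalIdeal (C.presheaf.stalk x) := by
    rw [mem_maximalIdeal_iff v, map_sub, AlgHom.commutes, Algebra.algebraMap_self_apply, sub_self]
  rw [hspan, Ideal.mem_span_singleton] at hdec
  obtain ⟨b, hb⟩ := hdec
  obtain ⟨c, hc⟩ : ∃ c, v (g * ↑w⁻¹) = c := ⟨_, rfl⟩
  rw [hc] at hb
  have h3 : τ⁻¹ • ω = c • (τ⁻¹ • KaehlerDifferential.D K C.functionField τ) +
      algebraMap (C.presheaf.stalk x) C.functionField b •
        KaehlerDifferential.D K C.functionField τ := by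
    rw [hω', sub_eq_iff_eq_add.mp hb, map_add, map_mul, ← IsScalarTower.algebraMap_apply, ← hτ,
      add_smul, smul_add, smul_smul, ← mul_assoc, inv_mul_cancel₀ hτ0, one_mul, add_comm,
      algebraMap_smul, smul_comm]
  have h4 := h t hspan
  rw [← hτ, h3, map_add, map_smul, h1, hreg _ (smul_mem_regularAt K b (D_mem_regularAt x t)),
    add_zero, smul_eq_mul, mul_one] at h4
  refine ⟨g, ?_, hg⟩
  have h5 : g * ↑w⁻¹ ∈ IsLocalRing.maximalIdeal (C.presheaf.stalk x) := by
    rw [mem_maximalIdeal_iff v, hc, h4]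
  have h6 := Ideal.mul_mem_right (w : C.presheaf.stalk x) _ h5
  rwa [Units.inv_mul_cancel_right] at h6

end IsEtaleCoordinate

end Residues

/-! ### Frames and germs -/

section Frames

variable {C : Scheme.{u}}

theorem res_res (M : C.Modules) {U V W : C.Opens} (h : V ≤ U) (h' : W ≤ V) (t : Γ(M, U)) :
    res M h' (res M h t) = res M (h'.trans h) t := by
  change (M.presheaf.map _ ≫ M.presheaf.map _) t = M.presheaf.map _ t
  rw [← M.presheaf.map_comp]
  rfl

theorem res_smul (M : C.Modules) {U V : C.Opens} (h : V ≤ U) (f : Γ(C, U)) (t : Γ(M, U)) :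
    res M h (f • t) = C.presheaf.map (homOfLE h).op f • res M h t :=
  Scheme.Modules.map_smul M (homOfLE h) f t

theorem IsFrame.exists_eq_sum {M : C.Modules} {U : C.Opens} {ι : Type} [Fintype ι]
    {e : ι → Γ(M, U)} (he : IsFrame M e) {V : C.Opens} (h : V ≤ U) (t : Γ(M, V)) :
    ∃ a : ι → Γ(C, V), t = ∑ i, a i • res M h (e i) := by
  have ht : t ∈ Submodule.span Γ(C, V) (Set.range fun i => res M h (e i)) := by
    rw [(he V h).2]
    trivial
  obtain ⟨a, ha⟩ := (Submodule.mem_span_range_iff_exists_fun _).mp ht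
  exact ⟨a, ha.symm⟩

theorem IsFrame.restrict {M : C.Modules} {U V : C.Opens} {ι : Type} {e : ι → Γ(M, U)}
    (he : IsFrame M e) (h : V ≤ U) : IsFrame M fun i => res M h (e i) := by
  intro W hW
  simp only [res_res]
  exact he W (hW.trans h)

variable [IsIntegral C]

theorem funGerm_injective {U : C.Opens} (hU : genericPoint C ∈ U) :
    Function.Injective (funGerm hU) :=
  germ_injective_of_isIntegral _ _ hU

theorem funGerm_map {U V : C.Opens} (h : V ≤ U) (hV : genericPoint C ∈ V) (f : Γ(C, U)) :
    funGerm hV (C.presheaf.map (homOfLE h).op f) = funGerm (h hV) f :=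
  TopCat.Presheaf.germ_res_apply C.presheaf (homOfLE h) _ hV f

/-- An open set without the generic point is empty, and has only the zero function. -/
theorem subsingleton_of_generic_notMem {V : C.Opens} (hV : genericPoint C ∉ V) :
    Subsingleton Γ(C, V) := by
  obtain rfl : V = ⊥ := by
    rw [eq_bot_iff]
    exact fun x hx => (hV (generic_mem hx)).elim
  infer_instance

/-- Finitely many elements of a stalk of the structure sheaf come from functions on a common
neighbourhood. -/
theorem exists_common_funGerm {ι : Type} [Finite ι] {U : C.Opens} {x : C} (hx : x ∈ U)
    (a : ι → C.presheaf.stalk x) :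
    ∃ (V : C.Opens) (_ : V ≤ U) (hxV : x ∈ V) (f : ι → Γ(C, V)),
      ∀ i, funGerm (generic_mem hxV) (f i) = algebraMap _ C.functionField (a i) := by
  classical
  have := Fintype.ofFinite ι
  have key : ∀ S : Finset ι, ∃ (V : C.Opens) (_ : V ≤ U) (hxV : x ∈ V) (f : ι → Γ(C, V)),
      ∀ i ∈ S, funGerm (generic_mem hxV) (f i) = algebraMap _ C.functionField (a i) := by
    intro S
    induction S using Finset.induction_on with
    | empty => exact ⟨U, le_rfl, hx, 0, by simp⟩
    | insert j S hj ih =>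
      obtain ⟨V, hV, hxV, f, hf⟩ := ih
      obtain ⟨W, hxW, g, hg⟩ := exists_stalk_germ (a j)
      refine ⟨V ⊓ W, inf_le_left.trans hV, ⟨hxV, hxW⟩, Function.update
        (fun i => C.presheaf.map (homOfLE (inf_le_left : V ⊓ W ≤ V)).op (f i)) j
        (C.presheaf.map (homOfLE (inf_le_right : V ⊓ W ≤ W)).op g), fun i hi => ?_⟩
      rcases eq_or_ne i j with rfl | hij
      · rw [Function.update_self, funGerm_map, hg]
      · rw [Function.update_of_ne hij, funGerm_map, hf i (Finset.mem_of_mem_insert_of_ne hi hij)]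
  obtain ⟨V, hV, hxV, f, hf⟩ := key Finset.univ
  exact ⟨V, hV, hxV, f, fun i => hf i (Finset.mem_univ i)⟩

variable {M : C.Modules} {U : C.Opens} {ι : Type} [Fintype ι] {e : ι → Γ(M, U)}

theorem germ_sum {V : C.Opens} (h : V ≤ U) (hV : genericPoint C ∈ V) (a : ι → Γ(C, V)) :
    germ M hV (∑ i, a i • res M h (e i)) =
      ∑ i, funGerm hV (a i) • germ M (h hV) (e i) := by
  rw [map_sum]
  refine Finset.sum_congr rfl fun i _ => ?_
  rw [germ_smul, germ_res]

theorem IsFrame.linearIndependent_germ (he : IsFrame M e) (hU : genericPoint C ∈ U) :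
    LinearIndependent C.functionField fun i => germ M hU (e i) := by
  rw [Fintype.linearIndependent_iff]
  intro c hc
  obtain ⟨V, hVU, hV, f, hf⟩ := exists_common_funGerm hU c
  have hf' : ∀ i, funGerm hV (f i) = c i := fun i => by
    rw [hf]
    exact ConcreteCategory.congr_hom (C.presheaf.stalkSpecializes_refl _) (c i)
  obtain ⟨W, hW, h₁, h₂, hw⟩ := exists_eq_of_germ M hV hV
    (fun _ : Unit => ∑ i, f i • res M hVU (e i)) (fun _ => 0) fun _ => by
      rw [germ_sum, map_zero, ← hc]
      exact Finset.sum_congr rfl fun i _ => by rw [hf']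
  have hw' : ∑ i, C.presheaf.map (homOfLE h₁).op (f i) • res M (h₁.trans hVU) (e i) = 0 := by
    have := hw ()
    rw [map_zero, map_sum] at this
    rw [← this]
    refine Finset.sum_congr rfl fun i _ => ?_
    rw [← res_res M hVU h₁, res_smul]
  intro i
  have h0 := Fintype.linearIndependent_iff.mp (he W (h₁.trans hVU)).1 _ hw' i
  rw [← hf', ← funGerm_map h₁ hW, h0, map_zero]

theorem IsFrame.span_germ (he : IsFrame M e) (hU : genericPoint C ∈ U) :
    ⊤ ≤ Submodule.span C.functionField (Set.range fun i => germ M hU (e i)) := by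
  intro s _
  obtain ⟨V, hV, t, rfl⟩ := exists_germ M s
  have hW : genericPoint C ∈ U ⊓ V := ⟨hU, hV⟩
  obtain ⟨a, ha⟩ := he.exists_eq_sum inf_le_left (res M (inf_le_right : U ⊓ V ≤ V) t)
  rw [← germ_res M (inf_le_right : U ⊓ V ≤ V) hW, ha, germ_sum inf_le_left hW]
  exact Submodule.sum_mem _ fun i _ => Submodule.smul_mem _ _ (Submodule.subset_span ⟨i, rfl⟩)

/-- The basis of the generic stalk given by the germs of a frame. -/
noncomputable def IsFrame.germBasis (he : IsFrame M e) (hU : genericPoint C ∈ U) :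
    Module.Basis ι C.functionField (GenericStalk M) :=
  .mk (he.linearIndependent_germ hU) (he.span_germ hU)

@[simp]
theorem IsFrame.germBasis_apply (he : IsFrame M e) (hU : genericPoint C ∈ U) (i : ι) :
    he.germBasis hU i = germ M hU (e i) := by
  simp [IsFrame.germBasis]

theorem IsFrame.germ_injective (he : IsFrame M e) {V : C.Opens} (h : V ≤ U)
    (hV : genericPoint C ∈ V) : Function.Injective (germ M hV) := by
  rw [injective_iff_map_eq_zero]
  intro t ht
  obtain ⟨a, rfl⟩ := he.exists_eq_sum h t
  rw [germ_sum] at ht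
  have := Fintype.linearIndependent_iff.mp (he.linearIndependent_germ (h hV)) _ ht
  refine Finset.sum_eq_zero fun i _ => ?_
  rw [(map_eq_zero_iff _ (funGerm_injective hV)).mp (this i), zero_smul]

/-- Sections over a smaller open set form a frame if their germs are linearly independent and
they span a given frame. -/
theorem IsFrame.of_span {ι : Type} {e : ι → Γ(M, U)} (he : IsFrame M e) {V : C.Opens} (h : V ≤ U)
    {κ : Type} [Fintype κ]
    {c : κ → Γ(M, V)} (hc : ∀ hV : genericPoint C ∈ V,
      LinearIndependent C.functionField fun j => germ M hV (c j))
    (hspan : ∀ i, ∃ a : κ → Γ(C, V), res M h (e i) = ∑ j, a j • c j) : IsFrame M c := by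
  intro W hW
  by_cases hgW : genericPoint C ∈ W
  · refine ⟨?_, ?_⟩
    · rw [Fintype.linearIndependent_iff]
      intro a ha j
      have h1 := congrArg (germ M hgW) ha
      rw [germ_sum, map_zero] at h1
      exact (map_eq_zero_iff _ (funGerm_injective hgW)).mp
        (Fintype.linearIndependent_iff.mp (hc (hW hgW)) _ h1 j)
    · rw [← top_le_iff, ← (he W (hW.trans h)).2, Submodule.span_le]
      rintro _ ⟨i, rfl⟩
      obtain ⟨a, ha⟩ := hspan i
      dsimp only
      rw [← res_res M h hW, ha, map_sum]
      refine Submodule.sum_mem _ fun j _ => ?_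
      rw [res_smul]
      exact Submodule.smul_mem _ _ (Submodule.subset_span ⟨j, rfl⟩)
  · have := subsingleton_of_generic_notMem hgW
    have : Subsingleton Γ(M, W) := Module.subsingleton Γ(C, W) _
    exact ⟨linearIndependent_of_subsingleton, Subsingleton.elim _ _⟩

end Frames

/-! ### The subbundle with a given generic stalk -/

section Saturation

/-- A subspace of `Lʳ`, with `L` the fraction field of a principal ideal domain `R`, contains part
of a basis of `Rʳ` of the same cardinality: the intersection of the subspace with `Rʳ` is saturated,
so that all elementary divisors may be taken to be `1`. -/
theorem exists_adapted_basis (R : Type*) {L : Type*} [CommRing R] [IsDomain R]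
    [IsPrincipalIdealRing R] [Field L] [Algebra R L] [IsFractionRing R L] {r s : ℕ}
    (H : Submodule L (Fin r → L)) (hH : Module.finrank L H = s) :
    ∃ (q : ℕ) (c : Module.Basis (Fin s ⊕ Fin q) R (Fin r → R)),
      ∀ i, (algebraMap R L ∘ c (Sum.inl i)) ∈ H := by
  classical
  let φ : (Fin r → R) →ₗ[R] (Fin r → L) := (Algebra.linearMap R L).compLeft (Fin r)
  have hφ : ∀ a, φ a = algebraMap R L ∘ a := fun _ => rfl
  have hinj : Function.Injective (algebraMap R L) := IsFractionRing.injective R L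
  let N : Submodule R (Fin r → R) := (H.restrictScalars R).comap φ
  obtain ⟨n, S⟩ := Submodule.smithNormalForm (Pi.basisFun R (Fin r)) N
  have ha0 : ∀ i, S.a i ≠ 0 := by
    intro i h0
    have h1 := S.snf i
    rw [h0, zero_smul] at h1
    exact S.bN.ne_zero i (Subtype.ext h1)
  have hmem : ∀ i, φ (S.bM (S.f i)) ∈ H := by
    intro i
    have h1 : φ (S.bN i : Fin r → R) ∈ H := (S.bN i).2
    rw [S.snf, map_smul, ← algebraMap_smul L (S.a i)] at h1
    exact (H.smul_mem_iff ((map_ne_zero_iff _ hinj).mpr (ha0 i))).mp h1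
  have hli : LinearIndependent L fun i => φ (S.bM (S.f i)) := by
    have h1 : LinearIndependent R fun i => φ (S.bM (S.f i)) := by
      have h2 := S.bM.linearIndependent.comp S.f S.f.injective
      refine h2.map' φ (LinearMap.ker_eq_bot.mpr fun a b hab => ?_)
      funext j
      exact hinj (congrFun hab j)
    exact (LinearIndependent.iff_fractionRing R L).mp h1
  have hspan : Submodule.span L (Set.range fun i => φ (S.bM (S.f i))) = H := by
    refine le_antisymm (Submodule.span_le.mpr ?_) fun h hh => ?_
    · rintro _ ⟨i, rfl⟩
      exact hmem i
    · obtain ⟨d, hd⟩ := IsLocalization.exist_integer_multiples (nonZeroDivisors R) Finset.univ h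
      choose b hb using fun i => hd i (Finset.mem_univ i)
      have hd0 : algebraMap R L d ≠ 0 :=
        (map_ne_zero_iff _ hinj).mpr (nonZeroDivisors.ne_zero d.2)
      have hb' : φ b = algebraMap R L d • h := by
        funext i
        exact (hb i).trans (algebraMap_smul L (d : R) (h i)).symm
      have hbN : b ∈ N := by
        change φ b ∈ H
        rw [hb']
        exact H.smul_mem _ hh
      have hsum := congrArg (fun z : N => φ (z : Fin r → R)) (S.bN.sum_repr ⟨b, hbN⟩)
      rw [← Submodule.smul_mem_iff _ hd0, ← hb']
      simp only at hsum
      rw [← hsum, Submodule.coe_sum, map_sum]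
      refine Submodule.sum_mem _ fun i _ => ?_
      rw [Submodule.coe_smul, S.snf, map_smul, map_smul]
      exact Submodule.smul_of_tower_mem _ _ (Submodule.smul_of_tower_mem _ _
        (Submodule.subset_span (Set.mem_range_self i)))
  obtain rfl : n = s := by
    rw [← hH, ← hspan, finrank_span_eq_card hli, Fintype.card_fin]
  let σ : Fin n ⊕ Fin (Fintype.card ((Set.range S.f)ᶜ : Set (Fin r))) ≃ Fin r :=
    (Equiv.sumCongr (Equiv.ofInjective S.f S.f.injective) (Fintype.equivFin _).symm).trans
      (Equiv.Set.sumCompl (Set.range S.f))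
  refine ⟨_, S.bM.reindex σ.symm, fun i => ?_⟩
  rw [← hφ, Module.Basis.reindex_apply]
  exact hmem i

variable {C : Scheme.{u}} [IsIntegral C]

/-- Near a point whose local ring is a principal ideal domain, a vector bundle has a frame whose first
members have germs in a given subspace of the generic stalk: a basis of the stalk adapted to the
subspace extends to a neighbourhood, together with its inverse change of basis. -/
theorem exists_adapted_frame {E : C.Modules} {r s : ℕ} (hE : IsVectorBundle E r)
    (H : Submodule C.functionField (GenericStalk E)) (hH : Module.finrank C.functionField H = s)
    (x : C) [IsPrincipalIdealRing (C.presheaf.stalk x)] :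
    ∃ (U : C.Opens) (hx : x ∈ U) (q : ℕ) (c : Fin s ⊕ Fin q → Γ(E, U)), IsFrame E c ∧
      ∀ i, germ E (generic_mem hx) (c (Sum.inl i)) ∈ H := by
  classical
  obtain ⟨U, hx, e, he⟩ := hE x
  let b := he.germBasis (generic_mem hx)
  obtain ⟨q, c, hc⟩ := exists_adapted_basis (C.presheaf.stalk x)
    (H.map b.equivFun.toLinearMap) (s := s) (by rw [LinearEquiv.finrank_map_eq, hH])
  obtain ⟨V, hVU, hxV, f, hf⟩ := exists_common_funGerm hx
    (Sum.elim (fun p : (Fin s ⊕ Fin q) × Fin r => c p.1 p.2)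
      fun p : Fin r × (Fin s ⊕ Fin q) => c.repr (Pi.single p.1 1) p.2)
  have hV := generic_mem hxV
  let c' : Fin s ⊕ Fin q → Γ(E, V) := fun j => ∑ i, f (Sum.inl (j, i)) • res E hVU (e i)
  have hgerm : ∀ j, germ E hV (c' j) = b.equivFun.symm (algebraMap _ C.functionField ∘ c j) := by
    intro j
    rw [germ_sum, Module.Basis.equivFun_symm_apply]
    refine Finset.sum_congr rfl fun i _ => ?_
    rw [hf, IsFrame.germBasis_apply]
    rfl
  have hli : LinearIndependent C.functionField fun j => germ E hV (c' j) := by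
    have h1 : LinearIndependent (C.presheaf.stalk x) fun j =>
        (Algebra.linearMap (C.presheaf.stalk x) C.functionField).compLeft (Fin r) (c j) := by
      refine c.linearIndependent.map' _ (LinearMap.ker_eq_bot.mpr fun a b hab => ?_)
      funext j
      exact IsFractionRing.injective _ C.functionField (congrFun hab j)
    have h2 := (LinearIndependent.iff_fractionRing (C.presheaf.stalk x) C.functionField).mp h1
    have h3 := h2.map' b.equivFun.symm.toLinearMap b.equivFun.symm.ker
    rw [show (fun j => germ E hV (c' j)) = _ from funext hgerm]
    exact h3
  refine ⟨V, hxV, q, c', he.of_span hVU (fun _ => hli) fun i =>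
    ⟨fun j => f (Sum.inr (i, j)), he.germ_injective hVU hV ?_⟩, fun i => ?_⟩
  · rw [germ_res, map_sum]
    have h1 := congrArg ((Algebra.linearMap (C.presheaf.stalk x) C.functionField).compLeft (Fin r))
      (c.sum_repr (Pi.single i 1))
    have h2 := congrArg b.equivFun.symm h1
    have h3 : ((Algebra.linearMap (C.presheaf.stalk x) C.functionField).compLeft (Fin r))
        (Pi.single i 1) = Pi.single i 1 := by
      funext j
      rcases eq_or_ne j i with rfl | hj
      · simp
      · simp [hj]
    rw [h3, map_sum, map_sum, Module.Basis.equivFun_symm_apply] at h2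
    have h4 : ∑ j, (Pi.single i 1 : Fin r → C.functionField) j • b j =
        germ E (generic_mem hx) (e i) := by
      rw [Finset.sum_eq_single i (fun j _ hj => by rw [Pi.single_eq_of_ne hj, zero_smul])
        (by simp), Pi.single_eq_same, one_smul, IsFrame.germBasis_apply]
    rw [h4] at h2
    refine h2.symm.trans (Finset.sum_congr rfl fun j _ => ?_)
    rw [germ_smul, hf, hgerm, map_smul, ← algebraMap_smul C.functionField, map_smul]
    rfl
  · rw [hgerm]
    obtain ⟨h, hh, hh'⟩ := hc i
    rw [← hh']
    simpa using hh

/-- The subbundle of `E` whose sections are those with generic germ in a given subspace, on a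
curve all of whose local rings are principal ideal domains. -/
def saturatedSubbundle {E : C.Modules} {r s : ℕ} (hE : IsVectorBundle E r)
    (hC : ∀ x : C, IsPrincipalIdealRing (C.presheaf.stalk x))
    (H : Submodule C.functionField (GenericStalk E)) (hH : Module.finrank C.functionField H = s) :
    Subbundle E s where
  sections U :=
    { carrier := {t | ∀ hU : genericPoint C ∈ U, germ E hU t ∈ H}
      zero_mem' := fun hU => by rw [map_zero]; exact H.zero_mem
      add_mem' := fun ha hb hU => by rw [map_add]; exact H.add_mem (ha hU) (hb hU)
      smul_mem' := fun f t ht hU => by rw [germ_smul]; exact H.smul_mem _ (ht hU) }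
  res_mem h t ht hV := by rw [germ_res]; exact ht (h hV)
  local_mem U t ht hU := by
    obtain ⟨V, h, hV, ht⟩ := ht _ hU
    rw [← germ_res E h hV]
    exact ht hV
  exists_frame x := by
    have := hC x
    obtain ⟨U, hx, q, c, hc, hcH⟩ := exists_adapted_frame hE H hH x
    refine ⟨U, hx, q, c, hc, fun V h => ?_⟩
    by_cases hV : genericPoint C ∈ V
    swap
    · have := subsingleton_of_generic_notMem hV
      have : Subsingleton Γ(E, V) := Module.subsingleton Γ(C, V) _
      exact Subsingleton.elim _ _
    have hU := h hV
    have hspan : Submodule.span C.functionField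
        (Set.range fun i => germ E hU (c (Sum.inl i))) = H := by
      have hli := (hc.linearIndependent_germ hU).comp Sum.inl Sum.inl_injective
      have := (hc.germBasis hU).finiteDimensional_of_finite
      refine Submodule.eq_of_le_of_finrank_eq (Submodule.span_le.mpr ?_) ?_
      · rintro _ ⟨i, rfl⟩
        exact hcH i
      · rw [hH]
        exact (finrank_span_eq_card hli).trans (Fintype.card_fin s)
    refine le_antisymm (fun t ht => ?_) (Submodule.span_le.mpr ?_)
    · obtain ⟨a, rfl⟩ := hc.exists_eq_sum h t
      have ht' : germ E hV (∑ i, a i • res E h (c i)) ∈ H := ht hV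
      rw [germ_sum, ← hspan, Submodule.mem_span_range_iff_exists_fun] at ht'
      obtain ⟨d, hd⟩ := ht'
      have hzero : ∀ j, a (Sum.inr j) = 0 := by
        intro j
        have h1 : ∑ i, (funGerm hV (a i) - Sum.elim d 0 i) • germ E hU (c i) = 0 := by
          simp only [sub_smul, Finset.sum_sub_distrib]
          rw [← hd, Fintype.sum_sum_type]
          simp
        have h2 := Fintype.linearIndependent_iff.mp (hc.linearIndependent_germ hU) _ h1 (Sum.inr j)
        exact (map_eq_zero_iff _ (funGerm_injective hV)).mp (by simpa using h2)
      rw [Fintype.sum_sum_type]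
      simp only [hzero, zero_smul, Finset.sum_const_zero, add_zero]
      exact Submodule.sum_mem _ fun i _ => Submodule.smul_mem _ _ (Submodule.subset_span ⟨i, rfl⟩)
    · rintro _ ⟨i, rfl⟩ _
      rw [germ_res]
      exact hcH i

end Saturation

/-! ### The residue form on sections supported at one point -/

section ResidueForm

/-- The descended form, which is defined by chosen representatives, may be computed with any
representatives. -/
theorem descend_mkQ {K M : Type*} [Field K] [AddCommGroup M] [Module K M] {r : ℕ}
    (f : M [⋀^Fin r]→ₗ[K] K) (N : Submodule K M) (h : ∀ s i, s i ∈ N → f s = 0)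
    (s : Fin r → M) : descend f N h (fun i => N.mkQ (s i)) = f s := by
  classical
  change f (fun i => (N.mkQ (s i)).out) = f s
  set s' : Fin r → M := fun i => (N.mkQ (s i)).out
  have hout : ∀ i, N.mkQ (s' i) = N.mkQ (s i) := fun i => Quotient.out_eq _
  have H : ∀ T : Finset (Fin r), f s = f (T.piecewise s' s) := by
    intro T
    induction T using Finset.induction_on with
    | empty => simp
    | insert i T hi ih =>
      rw [ih, Finset.piecewise_insert]
      have e : T.piecewise s' s =
          Function.update (T.piecewise s' s) i (s' i + (s i - s' i)) := by
        rw [add_sub_cancel]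
        ext j
        rcases eq_or_ne j i with rfl | hj
        · simp [hi]
        · simp [hj]
      conv_lhs => rw [e]
      rw [f.map_update_add, h (Function.update (T.piecewise s' s) i (s i - s' i)) i, add_zero]
      rw [Function.update_self]
      exact (Submodule.Quotient.eq N).mp (hout i).symm
  simpa using (H Finset.univ).symm

variable {C : Scheme.{u}} [IsIntegral C] {K : Type u} [Field K]
  [C.Over (Spec (CommRingCat.of K))] {r : ℕ} {E L : C.Modules}

theorem residueFormAt_mk (ψ : DetIso r E L) (ξ : DiffHom K L) (D : Set C) (x : C)
    (s : Fin r → GenericStalk E) (hs : ∀ i, s i ∈ twist K E D x) :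
    residueFormAt ψ ξ D x (fun i => Submodule.Quotient.mk ⟨s i, hs i⟩) =
      residue K x (genericForm ψ ξ s) :=
  descend_mkQ _ _ _ fun i => (⟨s i, hs i⟩ : twist K E D x)

theorem residueForm_apply {N : ℕ} (ψ : DetIso r E L) (ξ : DiffHom K L) (p : Fin N → C)
    (S : Fin r → quotSections K E (Set.range p) (r - 1)) :
    residueForm ψ ξ p S =
      ∑ j, residueFormAt ψ ξ (Set.range p) (p j) fun i => (S i).1 (p j) := by
  classical
  have h : ∀ T : Finset (Fin N), (∑ j ∈ T, (residueFormAt ψ ξ (Set.range p) (p j)).compLinearMap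
      (LinearMap.proj (p j) ∘ₗ (quotSections K E (Set.range p) (r - 1)).subtype)) S =
      ∑ j ∈ T, residueFormAt ψ ξ (Set.range p) (p j) fun i => (S i).1 (p j) := by
    intro T
    induction T using Finset.induction_on with
    | empty => rfl
    | insert j T hj ih =>
      rw [Finset.sum_insert hj, Finset.sum_insert hj, AlternatingMap.add_apply, ih]
      rfl
  exact h Finset.univ

/-- Outside of `D` the sheaf `E(D)/E(-mD)` is zero. -/
theorem mem_negTwist_of_notMem {D : Set C} {m : ℕ} {y : C} (hy : y ∉ D) {s : GenericStalk E}
    (hs : s ∈ twist K E D y) : s ∈ negTwist K E D m y := by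
  have h1 : (1 : C.presheaf.stalk y) ∈ idealAt D y := by
    rw [idealAt, if_neg hy]
    trivial
  have h2 := hs 1 h1
  rw [map_one, one_smul] at h2
  refine Submodule.subset_span ⟨1, ?_, s, h2, by rw [map_one, one_smul]⟩
  rw [← one_pow m]
  exact Ideal.pow_mem_pow h1 m

open Classical in
/-- The section of `E(D)/E(-mD)` which is represented by `s` at `x` and is zero elsewhere. -/
noncomputable def supportedSection {D : Set C} (m : ℕ) {x : C} (hx : IsClosed {x})
    {s : GenericStalk E} (U : C.Opens) (hxU : x ∈ U) (hs : ∀ y ∈ U, s ∈ twist K E D y)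
    (hU : ∀ y ∈ U, y ∈ D → y = x) : quotSections K E D m :=
  ⟨fun y => if h : y = x then Submodule.Quotient.mk ⟨s, h ▸ hs x hxU⟩ else 0, fun y => by
    by_cases hy : y = x
    · subst hy
      refine ⟨U, hxU, s, fun y' hy' => ⟨hs y' hy', ?_⟩⟩
      dsimp only
      split_ifs with h
      · rfl
      · refine ((Submodule.Quotient.mk_eq_zero _).mpr ?_).symm
        exact mem_negTwist_of_notMem (fun hD => h (hU y' hy' hD)) (hs y' hy')
    · refine ⟨⟨{x}ᶜ, hx.isOpen_compl⟩, hy, 0, fun y' hy' => ⟨zero_mem _, ?_⟩⟩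
      exact dif_neg hy'⟩

/-- If `W` is degenerate, then each residue `res_x (w₁ ∧ ⋯ ∧ s ∧ ⋯ ∧ wᵣ)` vanishes, for all
rational sections `s` with at most a simple pole at a point `x` of the divisor: the residue is the
value of the form at a section supported at `x`. -/
theorem residue_eq_zero_of_isDegenerate {N : ℕ} (ψ : DetIso r E L) (ξ : DiffHom K L)
    {p : Fin N → C} (hp : Function.Injective p) {W : Submodule K (GlobalSections E)}
    (hW : IsDegenerate (residueForm ψ ξ p) (W.map (toQuot K E (Set.range p) (r - 1))))
    (j : Fin N) (hclosed : IsClosed {p j}) (i₀ : Fin r) (w : Fin r → GlobalSections E)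
    (hw : ∀ i, i ≠ i₀ → w i ∈ W) (s : GenericStalk E) (U : C.Opens) (hU : p j ∈ U)
    (hs : ∀ y ∈ U, s ∈ twist K E (Set.range p) y) (hUp : ∀ y ∈ U, y ∈ Set.range p → y = p j) :
    residue K (p j) (genericForm ψ ξ
      (Function.update (fun i => globalGerm (K := K) E (w i)) i₀ s)) = 0 := by
  classical
  let q := supportedSection (r - 1) hclosed U hU hs hUp
  let S := Function.update (fun i => toQuot K E (Set.range p) (r - 1) (w i)) i₀ q
  have h0 := hW i₀ S fun i hi => by
    simp only [S, Function.update_of_ne hi]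
    exact Submodule.mem_map_of_mem (hw i hi)
  have hmem : ∀ i, Function.update (fun i => globalGerm (K := K) E (w i)) i₀ s i ∈
      twist K E (Set.range p) (p j) := by
    intro i
    rcases eq_or_ne i i₀ with rfl | hi
    · rw [Function.update_self]
      exact hs _ hU
    · rw [Function.update_of_ne hi]
      exact globalGerm_mem E _ _ _
  rw [residueForm_apply, Finset.sum_eq_single j] at h0
  · rw [← residueFormAt_mk ψ ξ (Set.range p) (p j) _ hmem, ← h0]
    congr 1
    funext i
    rcases eq_or_ne i i₀ with rfl | hi
    · have : S i = q := Function.update_self ..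
      rw [this]
      simp only [q, supportedSection, dif_pos]
      congr 2
      rw [Function.update_self]
    · have : S i = toQuot K E (Set.range p) (r - 1) (w i) := Function.update_of_ne hi ..
      rw [this]
      simp only [toQuot, LinearMap.coe_mk, AddHom.coe_mk]
      congr 2
      rw [Function.update_of_ne hi]
  · intro j' _ hj'
    refine AlternatingMap.map_coord_zero _ i₀ ?_
    have : S i₀ = q := Function.update_self ..
    rw [this]
    exact dif_neg fun h => hj' (hp h)
  · simp

end ResidueForm

/-! ### Rational points -/

section RationalPoints

variable {C : Scheme.{u}} {K : Type u} [Field K] [C.Over (Spec (CommRingCat.of K))]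

theorem range_eq_singleton_point {C : Scheme.{u}} {K : Type u} [Field K]
    (P : Spec (CommRingCat.of K) ⟶ C) :
    Set.range P = {point P} := by
  ext y
  constructor
  · rintro ⟨a, rfl⟩
    exact congrArg P (Subsingleton.elim (α := PrimeSpectrum K) _ _)
  · rintro rfl
    exact ⟨_, rfl⟩

theorem isClosed_point [IsProper (C ↘ Spec (CommRingCat.of K))]
    {P : Spec (CommRingCat.of K) ⟶ C} (hP : P ≫ (C ↘ Spec (CommRingCat.of K)) = 𝟙 _) :
    IsClosed {point P} := by
  have : Subsingleton (Spec (CommRingCat.of K)) := inferInstanceAs (Subsingleton (PrimeSpectrum K))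
  have := isClosedImmersion_of_comp_eq_id (C ↘ Spec (CommRingCat.of K)) P hP
  rw [← range_eq_singleton_point]
  exact P.isClosedEmbedding.isClosed_range

/-- The evaluation of functions at a rational point. -/
noncomputable def pointEval {P : Spec (CommRingCat.of K) ⟶ C}
    (hP : P ≫ (C ↘ Spec (CommRingCat.of K)) = 𝟙 _) : C.presheaf.stalk (point P) →ₐ[K] K where
  toRingHom := (Scheme.stalkClosedPointTo P).hom
  commutes' k := by
    have h1 := Scheme.germ_stalkClosedPointTo P ⊤ trivial
    have h2 : P.appTop ((C ↘ Spec (CommRingCat.of K)).appTop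
        ((Scheme.ΓSpecIso (CommRingCat.of K)).inv k)) =
        (Scheme.ΓSpecIso (CommRingCat.of K)).inv k := by
      have h3 := Scheme.Hom.comp_appTop P (C ↘ Spec (CommRingCat.of K))
      rw [hP, Scheme.Hom.id_appTop] at h3
      exact (ConcreteCategory.congr_hom h3 _).symm
    change (C.presheaf.germ ⊤ _ trivial ≫ Scheme.stalkClosedPointTo P) (const C K k) = k
    rw [h1]
    change (Scheme.ΓSpecIso (CommRingCat.of K)).hom ((Spec (CommRingCat.of K)).presheaf.map _
      (P.appTop ((C ↘ Spec (CommRingCat.of K)).appTop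
        ((Scheme.ΓSpecIso (CommRingCat.of K)).inv k)))) = k
    rw [h2]
    have h4 : ∀ (i : Opposite.op (⊤ : (Spec (CommRingCat.of K)).Opens) ⟶ Opposite.op ⊤)
        (f : Γ(Spec (CommRingCat.of K), ⊤)), (Spec (CommRingCat.of K)).presheaf.map i f = f := by
      intro i f
      obtain rfl : i = 𝟙 _ := Subsingleton.elim _ _
      rw [CategoryTheory.Functor.map_id]
      rfl
    refine (congrArg _ (h4 _ _)).trans ?_
    exact ConcreteCategory.congr_hom (Scheme.ΓSpecIso (CommRingCat.of K)).inv_hom_id k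

variable [IsIntegral C]

/-- A local parameter at a rational point is invertible at all other points of a neighbourhood. -/
theorem IsEtaleCoordinate.exists_isUnit_off_point {U : C.Opens} {z : Γ(C, U)}
    (hz : IsEtaleCoordinate K z) {x : C} (hx : x ∈ U) (v : C.presheaf.stalk x →ₐ[K] K)
    {t : C.presheaf.stalk x} (ht : IsLocalRing.maximalIdeal (C.presheaf.stalk x) = Ideal.span {t}) :
    ∃ W : C.Opens, x ∈ W ∧ ∀ y ∈ W, y ≠ x → ∃ a : C.presheaf.stalk y,
      algebraMap _ C.functionField a * algebraMap _ C.functionField t = 1 := by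
  -- the prime ideal of `x` is maximal and finitely generated
  let 𝔭 := (hz.isAffineOpen.primeIdealOf ⟨x, hx⟩).asIdeal
  have hmem : ∀ {y : C} (hy : y ∈ U) (a : Γ(C, U)),
      a ∈ (hz.isAffineOpen.primeIdealOf ⟨y, hy⟩).asIdeal ↔
        C.presheaf.germ U y hy a ∈ IsLocalRing.maximalIdeal (C.presheaf.stalk y) := by
    intro y hy a
    rw [IsAffineOpen.primeIdealOf_eq_map_closedPoint]
    rfl
  have hmax : 𝔭.IsMaximal := by
    have h1 : 𝔭 = RingHom.ker (v.toRingHom.comp (C.presheaf.germ U x hx).hom) := by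
      ext a
      rw [hmem hx, mem_maximalIdeal_iff v]
      rfl
    rw [h1]
    refine RingHom.ker_isMaximal_of_surjective _ fun k =>
      ⟨C.presheaf.map (homOfLE (le_top : U ≤ ⊤)).op (const C K k), ?_⟩
    change v (C.presheaf.germ U x hx _) = k
    rw [germ_res_const hx, AlgHom.commutes, Algebra.algebraMap_self_apply]
  have hnoeth : IsNoetherianRing Γ(C, U) := by
    let _ : Algebra (Polynomial K) Γ(C, U) := (polyHom K z).toAlgebra
    have : Algebra.Etale (Polynomial K) Γ(C, U) := hz.etale
    exact Algebra.FiniteType.isNoetherianRing (Polynomial K) _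
  obtain ⟨n, g, hg⟩ := Submodule.fg_iff_exists_fin_generating_family.mp
    ((isNoetherianRing_iff_ideal_fg _).mp hnoeth 𝔭)
  have hdvd : ∀ i, ∃ b, C.presheaf.germ U x hx (g i) = t * b := by
    intro i
    have h1 : g i ∈ 𝔭 := hg ▸ Submodule.subset_span (Set.mem_range_self i)
    rw [hmem hx, ht, Ideal.mem_span_singleton] at h1
    exact h1
  choose b hb using hdvd
  obtain ⟨W, hWU, hxW, f, hf⟩ := exists_common_funGerm hx (fun o : Option (Fin n) => o.elim t b)
  refine ⟨W, hxW, fun y hy hyx => ?_⟩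
  have hu : IsUnit (C.presheaf.germ W y hy (f none)) := by
    by_contra hu
    have hle : 𝔭 ≤ (hz.isAffineOpen.primeIdealOf ⟨y, hWU hy⟩).asIdeal := by
      rw [← hg, Submodule.span_le]
      rintro _ ⟨i, rfl⟩
      rw [SetLike.mem_coe, hmem (hWU hy)]
      have h1 : C.presheaf.germ U y (hWU hy) (g i) =
          C.presheaf.germ W y hy (f none) * C.presheaf.germ W y hy (f (some i)) := by
        apply IsFractionRing.injective (C.presheaf.stalk y) C.functionField
        rw [map_mul, algebraMap_germ, algebraMap_germ, algebraMap_germ, hf, hf,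
          ← algebraMap_germ hx, hb, map_mul]
        rfl
      rw [h1]
      exact Ideal.mul_mem_right _ _ hu
    have h2 := hmax.eq_of_le (hz.isAffineOpen.primeIdealOf ⟨y, hWU hy⟩).isPrime.ne_top hle
    have h3 := congrArg hz.isAffineOpen.fromSpec (PrimeSpectrum.ext h2)
    rw [IsAffineOpen.fromSpec_primeIdealOf, IsAffineOpen.fromSpec_primeIdealOf] at h3
    exact hyx h3.symm
  obtain ⟨a, ha⟩ := hu.exists_left_inv
  refine ⟨a, ?_⟩
  have h1 : algebraMap (C.presheaf.stalk x) C.functionField t =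
      algebraMap (C.presheaf.stalk y) C.functionField (C.presheaf.germ W y hy (f none)) := by
    rw [algebraMap_germ]
    exact (hf none).symm
  rw [h1, ← map_mul, ha, map_one]

/-- A rational section with a simple pole at `x` is a section of `E(D)` near `x`. -/
theorem exists_twist_nhd {E : C.Modules} {D : Set C} (hD : D.Finite)
    (hDc : ∀ y ∈ D, IsClosed {y}) {U : C.Opens} {z : Γ(C, U)}
    (hz : IsEtaleCoordinate K z) {x : C} (hx : x ∈ U) (hxD : x ∈ D)
    (v : C.presheaf.stalk x →ₐ[K] K) {t : C.presheaf.stalk x}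
    (ht : IsLocalRing.maximalIdeal (C.presheaf.stalk x) = Ideal.span {t})
    (ht0 : algebraMap _ C.functionField t ≠ 0) {U₁ : C.Opens}
    (hx₁ : x ∈ U₁) (e : Γ(E, U₁)) :
    ∃ W : C.Opens, x ∈ W ∧ (∀ y ∈ W, (algebraMap _ C.functionField t)⁻¹ •
      germ E (generic_mem hx₁) e ∈ twist K E D y) ∧ ∀ y ∈ W, y ∈ D → y = x := by
  obtain ⟨W, hxW, hW⟩ := hz.exists_isUnit_off_point hx v ht
  have hclosed : IsClosed (D \ {x}) := by
    rw [← Set.biUnion_of_singleton (D \ {x})]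
    exact (hD.subset Set.sdiff_subset).isClosed_biUnion fun y hy => hDc y hy.1
  have hsec : ∀ y ∈ U₁, germ E (generic_mem hx₁) e ∈ stalkAt K E y := fun y hy => ⟨U₁, hy, e, rfl⟩
  refine ⟨U₁ ⊓ W ⊓ ⟨(D \ {x})ᶜ, hclosed.isOpen_compl⟩, ⟨⟨hx₁, hxW⟩, fun h => h.2 rfl⟩,
    fun y hy => ?_, fun y hy hyD => by_contra fun h => hy.2 ⟨hyD, h⟩⟩
  by_cases hyx : y = x
  · subst hyx
    intro a ha
    rw [idealAt, if_pos hxD, ht, Ideal.mem_span_singleton] at ha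
    obtain ⟨b, rfl⟩ := ha
    rw [smul_smul, map_mul, mul_right_comm, mul_inv_cancel₀ ht0, one_mul]
    exact IsSectionAt.smul (hsec _ hx₁) b
  · obtain ⟨a, ha⟩ := hW y hy.1.2 hyx
    rw [← eq_inv_of_mul_eq_one_left ha]
    exact stalkAt_le_twist E D y (IsSectionAt.smul (hsec y hy.1.1) a)

end RationalPoints

/-! ### Alternating forms and independent vectors -/

section LinearAlgebra

/-- A nonzero form of top degree stays nonzero when independent vectors are inserted in all entries
but one: the last entry can then be taken in any given basis. -/
theorem exists_map_cons_ne_zero {L M Q : Type*} [Field L] [AddCommGroup M] [Module L M]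
    [AddCommGroup Q] [Module L Q] {m : ℕ} {f : M [⋀^Fin (m + 1)]→ₗ[L] Q} (hf : f ≠ 0)
    (b : Module.Basis (Fin (m + 1)) L M) {g : Fin m → M} (hg : LinearIndependent L g) :
    ∃ i, f (Fin.cons (b i) g) ≠ 0 := by
  classical
  by_contra! h
  refine hf ?_
  have hupd : ∀ x : M, (Fin.cons x g : Fin (m + 1) → M) =
      Function.update (Fin.cons 0 g) 0 x := fun x => (Fin.update_cons_zero _ _ _).symm
  have hall : ∀ x, f (Fin.cons x g) = 0 := by
    intro x
    have : f.toMultilinearMap.toLinearMap (Fin.cons 0 g) 0 = 0 := b.ext fun i => by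
      have := h i
      rw [hupd] at this
      exact this
    rw [hupd]
    exact LinearMap.congr_fun this x
  have := b.finiteDimensional_of_finite
  obtain ⟨x, hx⟩ : ∃ x, x ∉ Submodule.span L (Set.range g) := by
    by_contra! hx
    have h1 := finrank_range_le_card (R := L) g
    have htop : Submodule.span L (Set.range g) = ⊤ := eq_top_iff.mpr fun x _ => hx x
    rw [Set.finrank, htop, finrank_top, Module.finrank_eq_card_basis b,
      Fintype.card_fin, Fintype.card_fin] at h1
    omega
  have hli : LinearIndependent L (Fin.cons x g : Fin (m + 1) → M) :=
    linearIndependent_finCons.mpr ⟨hg, hx⟩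
  let e := basisOfLinearIndependentOfCardEqFinrank hli (Module.finrank_eq_card_basis b).symm
  refine e.ext_alternating fun v hv => ?_
  have h1 := f.map_perm e (Equiv.ofBijective v (Finite.injective_iff_bijective.mp hv))
  have h2 : f e = 0 := by
    rw [coe_basisOfLinearIndependentOfCardEqFinrank]
    exact hall x
  rw [h2, smul_zero] at h1
  exact h1

/-- A subspace is contained in one of any prescribed larger dimension. -/
theorem exists_le_finrank_eq {L M : Type*} [Field L] [AddCommGroup M] [Module L M]
    [FiniteDimensional L M] (H : Submodule L M) {d : ℕ} (h₁ : Module.finrank L H ≤ d)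
    (h₂ : d ≤ Module.finrank L M) :
    ∃ H' : Submodule L M, H ≤ H' ∧ Module.finrank L H' = d := by
  induction d, h₁ using Nat.le_induction with
  | base => exact ⟨H, le_rfl, rfl⟩
  | succ d _ ih =>
    obtain ⟨H', hle, hd⟩ := ih (by omega)
    obtain ⟨x, hx⟩ : ∃ x, x ∉ H' := by
      by_contra! hx
      have htop : H' = ⊤ := eq_top_iff.mpr fun x _ => hx x
      rw [htop, finrank_top] at hd
      omega
    let g : Fin d → M := fun i => (Module.finBasisOfFinrankEq L H' hd i : M)
    have hg : LinearIndependent L g :=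
      (Module.finBasisOfFinrankEq L H' hd).linearIndependent.map' H'.subtype H'.ker_subtype
    have hspan : Submodule.span L (Set.range g) = H' := by
      have := congrArg (Submodule.map H'.subtype) (Module.finBasisOfFinrankEq L H' hd).span_eq
      rwa [Submodule.map_top, Submodule.range_subtype, Submodule.map_span, ← Set.range_comp] at this
    refine ⟨Submodule.span L (Set.range (Fin.cons x g : Fin (d + 1) → M)), hle.trans ?_, ?_⟩
    · rw [← hspan, Fin.range_cons]
      exact Submodule.span_mono (Set.subset_insert _ _)
    · rw [finrank_span_eq_card (linearIndependent_finCons.mpr ⟨hg, hspan ▸ hx⟩), Fintype.card_fin]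

end LinearAlgebra

/-! ### Zeros of the form on a space of sections -/

section FormZeros

variable {C : Scheme.{u}} [IsIntegral C] {K : Type u} [Field K]
  [C.Over (Spec (CommRingCat.of K))] {E L : C.Modules}

/-- The form does not vanish identically, since `ψ` carries a frame of `E` to a generator of `L`. -/
theorem genericForm_ne_zero {r : ℕ} (hE : IsVectorBundle E r) (ψ : DetIso r E L)
    {ξ : DiffHom K L} (hξ : ξ.NeZero) : genericForm ψ ξ ≠ 0 := by
  obtain ⟨U, hU, t, ht⟩ := hξ
  obtain ⟨U₁, hU₁, e, he⟩ := hE (genericPoint C)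
  intro h0
  have hW : genericPoint C ∈ U ⊓ U₁ := ⟨hU, hU₁⟩
  obtain ⟨a, ha⟩ := (ψ.isFrame _ (he.restrict (inf_le_right : U ⊓ U₁ ≤ U₁))).exists_eq_sum le_rfl
    (res L (inf_le_left : U ⊓ U₁ ≤ U) t)
  refine ht ?_
  rw [← ξ.app_res (inf_le_left : U ⊓ U₁ ≤ U) hW, ha, Fintype.sum_unique, ξ.app_smul, ξ.app_res]
  have h1 := genericValue_germ ψ ξ hW (fun i => res E (inf_le_right : U ⊓ U₁ ≤ U₁) (e i)) _
    fun _ => rfl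
  have h2 : genericValue ψ ξ (fun i => germ E hW (res E (inf_le_right : U ⊓ U₁ ≤ U₁) (e i))) = 0 :=
    congrArg (fun f : GenericStalk E [⋀^Fin r]→ₗ[C.functionField] Ω[C.functionField⁄K] =>
      f fun i => germ E hW (res E (inf_le_right : U ⊓ U₁ ≤ U₁) (e i))) h0
  rw [h2] at h1
  change funGerm hW _ • localForm ψ ξ hW _ = 0
  rw [← h1, smul_zero]

/-- The differentials obtained from the form by inserting sections of a finite dimensional space and
one member of a frame have a uniformly bounded number of rational zeros. -/
theorem IsEtaleCoordinate.exists_card_zeros_genericForm_le {m : ℕ} (ψ : DetIso (m + 1) E L)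
    (ξ : DiffHom K L) (V : Submodule K (GlobalSections E)) [FiniteDimensional K V]
    {U : C.Opens} {z : Γ(C, U)} (hz : IsEtaleCoordinate K z) (hU : genericPoint C ∈ U)
    (b : Fin (m + 1) → GenericStalk E) :
    ∃ N : ℕ, ∀ w : Fin m → GlobalSections E, (∀ i, w i ∈ V) → ∀ i,
      genericForm ψ ξ (Fin.cons (b i) fun l => globalGerm (K := K) E (w l)) ≠ 0 →
      ∀ S : Finset C, (∀ x ∈ S, x ∈ U ∧ Nonempty (C.presheaf.stalk x →ₐ[K] K) ∧
        ∃ a ∈ IsLocalRing.maximalIdeal (C.presheaf.stalk x),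
          genericForm ψ ξ (Fin.cons (b i) fun l => globalGerm (K := K) E (w l)) =
            algebraMap _ C.functionField a •
              KaehlerDifferential.D K C.functionField (funGerm hU z)) → S.card ≤ N := by
  let ε := hz.differentialEquiv hU
  let V' : Submodule K (GenericStalk E) :=
    V.map (globalGerm E) ⊔ Submodule.span K (Set.range b)
  have : FiniteDimensional K (Submodule.span K (Set.range b)) :=
    FiniteDimensional.span_of_finite K (Set.finite_range b)
  -- the values of the form on `V'` span the image of a tensor power of `V'`
  let Φ : MultilinearMap K (fun _ : Fin (m + 1) => V') C.functionField :=
    (((ε.symm.toLinearMap.compMultilinearMap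
      (genericForm ψ ξ).toMultilinearMap).restrictScalars K).compLinearMap fun _ => V'.subtype)
  let F₀ := LinearMap.range (PiTensorProduct.lift Φ)
  obtain ⟨N, hN⟩ := hz.exists_card_zeros_le F₀
  refine ⟨N, fun w hw i hne S hS => ?_⟩
  let s : Fin (m + 1) → V' := Fin.cons
    ⟨b i, Submodule.mem_sup_right (Submodule.subset_span (Set.mem_range_self i))⟩
    fun l => ⟨globalGerm E (w l), Submodule.mem_sup_left (Submodule.mem_map_of_mem (hw l))⟩
  have hs : (fun l => (s l : GenericStalk E)) =
      Fin.cons (b i) fun l => globalGerm (K := K) E (w l) := by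
    funext l
    refine Fin.cases ?_ (fun l => ?_) l
    · rfl
    · rfl
  have hΦ : Φ s = ε.symm (genericForm ψ ξ
      (Fin.cons (b i) fun l => globalGerm (K := K) E (w l))) := by
    rw [← hs]
    rfl
  refine hN (Φ s) ⟨PiTensorProduct.tprod K s, PiTensorProduct.lift.tprod _⟩ ?_ S fun x hx => ?_
  · rw [hΦ]
    exact fun h => hne (ε.symm.map_eq_zero_iff.mp h)
  · obtain ⟨hxU, hv, a, ha, hform⟩ := hS x hx
    refine ⟨hxU, hv, a, ha, ?_⟩
    rw [hΦ, hform]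
    exact (hz.differentialEquiv_symm_smul hU _).symm

/-- If `W` is degenerate, then for `w₂, …, wᵣ` in `W` and a local section `e` of `E`, the
differential `ξ (ψ (e ∧ w₂ ∧ ⋯ ∧ wᵣ))` vanishes at the points of the divisor. -/
theorem IsEtaleCoordinate.exists_genericForm_eq_of_isDegenerate {m N : ℕ} (ψ : DetIso (m + 1) E L)
    (ξ : DiffHom K L) {p : Fin N → C} (hp : Function.Injective p) (hpc : ∀ j, IsClosed {p j})
    {W : Submodule K (GlobalSections E)}
    (hW : IsDegenerate (residueForm ψ ξ p) (W.map (toQuot K E (Set.range p) (m + 1 - 1))))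
    {U : C.Opens} {z : Γ(C, U)} (hz : IsEtaleCoordinate K z) {j : Fin N} (hx : p j ∈ U)
    (v : C.presheaf.stalk (p j) →ₐ[K] K) {U₁ : C.Opens} (hx₁ : p j ∈ U₁) (e : Γ(E, U₁))
    {w : Fin m → GlobalSections E} (hw : ∀ i, w i ∈ W) :
    ∃ a ∈ IsLocalRing.maximalIdeal (C.presheaf.stalk (p j)),
      genericForm ψ ξ (Fin.cons (germ E (generic_mem hx₁) e)
        fun l => globalGerm (K := K) E (w l)) = algebraMap _ C.functionField a •
          KaehlerDifferential.D K C.functionField (funGerm (generic_mem hx) z) := by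
  refine hz.exists_eq_smul_of_residue_eq_zero hx v
    (genericForm_regular ψ ξ fun i => ?_) fun t ht => ?_
  · refine Fin.cases ?_ (fun l => ?_) i
    · exact ⟨U₁, hx₁, e, rfl⟩
    · exact ⟨⊤, trivial, w l, rfl⟩
  · by_cases ht0 : algebraMap _ C.functionField t = 0
    · rw [ht0, inv_zero, zero_smul, map_zero]
    obtain ⟨O, hxO, hO, hO'⟩ := exists_twist_nhd (K := K) (Set.finite_range p)
      (by rintro _ ⟨i, rfl⟩; exact hpc i) hz hx (Set.mem_range_self j) v ht ht0 hx₁ e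
    have h := residue_eq_zero_of_isDegenerate ψ ξ hp hW j (hpc j) 0 (Fin.cons 0 w)
      (fun i hi => by
        obtain ⟨l, rfl⟩ := Fin.exists_succ_eq.mpr hi
        exact hw l) _ O hxO hO hO'
    rw [AlternatingMap.map_update_smul] at h
    rw [← h]
    congr 3
    funext i
    refine Fin.cases ?_ (fun l => ?_) i
    · rfl
    · rfl

end FormZeros

/-! ### Degenerate subspaces -/

/-- If the number of points is large, then any `r - 1` sections in a degenerate subspace of `V` are
linearly dependent at the generic point: otherwise on each chart of a finite cover one of the
differentials `ξ (ψ (e ∧ w₂ ∧ ⋯ ∧ wᵣ))`, with `e` in a frame, is nonzero, and it vanishes at all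
points of the divisor in the chart. -/
theorem exists_bound_not_linearIndependent {K : Type u} [Field K] {C : Scheme.{u}}
    [C.Over (Spec (CommRingCat.of K))] [IsIntegral C] [IsProper (C ↘ Spec (CommRingCat.of K))]
    [SmoothOfRelativeDimension 1 (C ↘ Spec (CommRingCat.of K))] {m : ℕ} {E L : C.Modules}
    (hE : IsVectorBundle E (m + 1)) (ψ : DetIso (m + 1) E L) {ξ : DiffHom K L} (hξ : ξ.NeZero)
    (V : Submodule K (GlobalSections E)) [FiniteDimensional K V] :
    ∃ N : ℕ, ∀ N' : ℕ, N < N' → ∀ P : Fin N' → (Spec (CommRingCat.of K) ⟶ C),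
      (∀ i, P i ≫ (C ↘ Spec (CommRingCat.of K)) = 𝟙 _) →
      (∀ i j, i ≠ j → Disjoint (Set.range (P i)) (Set.range (P j))) →
      ∀ W : Submodule K (GlobalSections E), W ≤ V →
        IsDegenerate (residueForm ψ ξ fun i => point (P i))
          (W.map (toQuot K E (Set.range fun i => point (P i)) (m + 1 - 1))) →
        ∀ w : Fin m → GlobalSections E, (∀ i, w i ∈ W) →
          ¬ LinearIndependent C.functionField fun i => globalGerm (K := K) E (w i) := by
  classical
  have hcompact : CompactSpace C :=
    QuasiCompact.compactSpace_of_compactSpace (C ↘ Spec (CommRingCat.of K))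
  choose U hxU z hz using exists_isEtaleCoordinate (C := C) K
  choose U₁ hxU₁ e he using hE
  have hgen := fun x => generic_mem (hxU x)
  have hgen₁ := fun x => generic_mem (hxU₁ x)
  choose B hB using fun x => (hz x).exists_card_zeros_genericForm_le ψ ξ V (hgen x)
    fun i => germ E (hgen₁ x) (e x i)
  obtain ⟨T, -, hT⟩ := isCompact_univ.elim_nhds_subcover (fun x => (U x ⊓ U₁ x : C.Opens).1)
    fun x _ => (U x ⊓ U₁ x).isOpen.mem_nhds ⟨hxU x, hxU₁ x⟩
  refine ⟨∑ x ∈ T, B x, fun N' hN' P hP hdisj W hWV hW w hw hli => hN'.not_ge ?_⟩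
  have hinj : Function.Injective fun i => point (P i) := by
    intro i j hij
    by_contra hne
    have h := hdisj i j hne
    rw [range_eq_singleton_point, range_eq_singleton_point, Set.disjoint_singleton] at h
    exact h hij
  let S : C → Finset C := fun x =>
    (Finset.univ.image fun i => point (P i)).filter fun y => y ∈ U x ⊓ U₁ x
  have hcard : ∀ x, (S x).card ≤ B x := by
    intro x
    obtain ⟨i, hi⟩ := exists_map_cons_ne_zero (genericForm_ne_zero
      (fun x => ⟨U₁ x, hxU₁ x, e x, he x⟩) ψ hξ) ((he x).germBasis (hgen₁ x)) hli
    rw [IsFrame.germBasis_apply] at hi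
    refine hB x w (fun l => hWV (hw l)) i hi (S x) fun y hy => ?_
    obtain ⟨hyP, hyU⟩ := Finset.mem_filter.mp hy
    obtain ⟨j, -, rfl⟩ := Finset.mem_image.mp hyP
    exact ⟨hyU.1, ⟨pointEval (hP j)⟩, (hz x).exists_genericForm_eq_of_isDegenerate ψ ξ hinj
      (fun j => isClosed_point (hP j)) hW hyU.1 (pointEval (hP j)) hyU.2 (e x i) hw⟩
  calc N' = (Finset.univ.image fun i => point (P i)).card := by
        rw [Finset.card_image_of_injective _ hinj, Finset.card_univ, Fintype.card_fin]
    _ ≤ (T.biUnion S).card := Finset.card_le_card fun y hy => by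
        obtain ⟨x, hx, hyx⟩ := Set.mem_iUnion₂.mp (hT (Set.mem_univ y))
        exact Finset.mem_biUnion.mpr ⟨x, hx, Finset.mem_filter.mpr ⟨hy, hyx⟩⟩
    _ ≤ ∑ x ∈ T, (S x).card := Finset.card_biUnion_le
    _ ≤ ∑ x ∈ T, B x := Finset.sum_le_sum fun x _ => hcard x

end CurveForms

theorem mainTheorem9 {K : Type u} [Field K]
    (C : Scheme.{u}) [C.Over (Spec (CommRingCat.of K))] [IsIntegral C]
    [IsProper (C ↘ Spec (CommRingCat.of K))]
    [SmoothOfRelativeDimension 1 (C ↘ Spec (CommRingCat.of K))]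
    (r : ℕ) (hr : 1 ≤ r) (E L : C.Modules)
    (hE : CurveForms.IsVectorBundle E r) (hL : CurveForms.IsVectorBundle L 1)
    (ψ : CurveForms.DetIso r E L) (ξ : CurveForms.DiffHom K L) (hξ : ξ.NeZero)
    (k n : ℕ) (hn : n ≤ k)
    (V : Submodule K (CurveForms.GlobalSections E)) [FiniteDimensional K V]
    (hV : Module.finrank K V = k)
    (hVn : ∀ W : Submodule K (CurveForms.GlobalSections E), W ≤ V → Module.finrank K W = n →
      ∀ s : ℕ, s + 2 = r → ∀ G : CurveForms.Subbundle E s, ¬ ∀ w ∈ W, w ∈ G.sections ⊤) :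
    ∃ N : ℕ, 0 < N ∧ ∀ N' : ℕ, N < N' →
      ∀ P : Fin N' → (Spec (CommRingCat.of K) ⟶ C),
        (∀ i, P i ≫ (C ↘ Spec (CommRingCat.of K)) = 𝟙 _) →
        (∀ i j, i ≠ j → Disjoint (Set.range (P i)) (Set.range (P j))) →
        ∀ W : Submodule K (CurveForms.GlobalSections E), W ≤ V → Module.finrank K W = n →
          ¬ CurveForms.IsDegenerate
            (CurveForms.residueForm ψ ξ fun i => CurveForms.point (P i))
            (W.map (CurveForms.toQuot K E
              (Set.range fun i => CurveForms.point (P i)) (r - 1))) := by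
  obtain ⟨m, rfl⟩ : ∃ m, r = m + 1 := ⟨r - 1, by omega⟩
  obtain ⟨N, hN⟩ := CurveForms.exists_bound_not_linearIndependent hE ψ hξ V
  refine ⟨N + 1, N.succ_pos, fun N' hN' P hP hdisj W hWV hWn hdeg => ?_⟩
  have hdep := hN N' (by omega) P hP hdisj W hWV hdeg
  obtain ⟨U₁, hU₁, e, he⟩ := hE (genericPoint C)
  let b := he.germBasis hU₁
  have := b.finiteDimensional_of_finite
  have hrank : Module.finrank C.functionField (CurveForms.GenericStalk E) = m + 1 := by
    rw [Module.finrank_eq_card_basis b, Fintype.card_fin]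
  -- the subspace of the generic stalk spanned by `W` has dimension at most `r - 2`
  let H₀ := Submodule.span C.functionField (CurveForms.globalGerm (K := K) E '' W)
  have hH₀ : Module.finrank C.functionField H₀ < m := by
    by_contra! hle
    obtain ⟨g, hgmem, -, hgli⟩ := Submodule.exists_fun_fin_finrank_span_eq C.functionField
      (CurveForms.globalGerm (K := K) E '' (W : Set (CurveForms.GlobalSections E)))
    choose w hw hwg using fun i : Fin m => hgmem (Fin.castLE hle i)
    refine hdep w hw ?_
    have h1 := hgli.comp _ (Fin.castLE_injective hle)
    convert h1 using 1
    funext i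
    exact hwg i
  obtain ⟨H, hle, hH⟩ := CurveForms.exists_le_finrank_eq H₀ (d := m - 1) (by omega) (by omega)
  have hC : ∀ x : C, IsPrincipalIdealRing (C.presheaf.stalk x) := fun x => by
    obtain ⟨U, hx, z, hz⟩ := CurveForms.exists_isEtaleCoordinate (C := C) K x
    exact hz.isPrincipalIdealRing_stalk hx
  exact hVn W hWV hWn (m - 1) (by omega) (CurveForms.saturatedSubbundle hE hC H hH)
    fun w hw _ => hle (Submodule.subset_span ⟨w, hw, rfl⟩)
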